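/- Let $\mathbb F$ be a field (of any characteristic). **Okubo algebras.** For $\alpha,\beta\in\mathbb F^\times$ let $\mathcal O_{\alpha,\beta}$ be the $8$-dimensional $\mathbb F$-algebra with basis $\tilde z_{i,j}$, $0\le i,j\le 2$, $(i,j)\ne(0,0)$, and product $$\tilde z_{i,j}*\tilde z_{i',j'}=\varepsilon\,\alpha^{\lfloor (i+i')/3\rfloor}\beta^{\lfloor (j+j')/3\rfloor}\,\tilde z_{i+i',\,j+j'}$$ (indices of $\tilde z$ modulo $3$), where, with $\Delta=ij'-ji'\in\mathbb Z/3$, $\varepsilon=0$ if $\Delta=2$ or $i+i'\equiv 0\equiv j+j'$, $\varepsilon=-1$ if $\Delta=1$, and $\varepsilon=1$ otherwise. Its norm is the quadratic form $$\mathrm n\Bigl(\sum x_{i,j}\tilde z_{i,j}\Bigr)=\alpha x_{1,0}x_{2,0}+\beta x_{0,1}x_{0,2}+\alpha\beta\,(x_{1,1}x_{2,2}+x_{1,2}x_{2,1}).$$ $(\mathcal O_{1,1},*,\mathrm n)$ is the *split Okubo algebra*. An *Okubo algebra* over $\mathbb F$ is a triple $(\mathcal O,*,\mathrm n)$, with $*$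 a bilinear product and $\mathrm n$ a quadratic form on the $\mathbb F$-vector space $\mathcal O$, that becomes isomorphic (with product and norm) to the split Okubo algebra after extension of scalars to an algebraic closure $\overline{\mathbb F}$. Write $\mathrm n(x,y)=\mathrm n(x+y)-\mathrm n(x)-\mathrm n(y)$. The grading $\Gamma_{\alpha,\beta}$ of $\mathcal O_{\alpha,\beta}$ by $(\mathbb Z/3)^2$ is the one with $\deg\tilde z_{i,j}=(i,j)$. **Gradings.** A grading $\Gamma:\mathcal A=\bigoplus_{g\in G}\mathcal A_g$ by an abelian group $G$ satisfies $\mathcal A_g\mathcal A_h\subseteq\mathcal A_{gh}$; its support is $\{g:\mathcal A_g\ne0\}$. It is *special* if $\mathcal A_e=0$. Graded algebras $(\mathcal A,\Gamma)$ and $(\mathcal B,\Gamma')$ are *equivalent*, $(\mathcal A,\Gamma)\simeq_{\rm eq}(\mathcal B,\Gamma')$, if some algebra isomorphism $\mathcal A\to\mathcal B$ takes each $\mathcal A_g$, $g$ in the support, onto some homogeneous component of $\Gamma'$. $\mathrm{Aut}(\Gamma)$ is the group of equivalences of $(\mathcal A,\Gamma)$ with itself, $\mathrm{Stab}(\Gamma)$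 is the subgroup of those that fix each homogeneous component, and $W(\Gamma)=\mathrm{Aut}(\Gamma)/\mathrm{Stab}(\Gamma)$. **Theorem.** Let $\Gamma:\mathcal O=\bigoplus_{g\in G}\mathcal O_g$ be a special grading by an abelian group on an Okubo algebra $(\mathcal O,*,\mathrm n)$ over $\mathbb F$. Then: 1. The short exact sequence $1\to\mathrm{Stab}(\Gamma)\to\mathrm{Aut}(\Gamma)\to W(\Gamma)\to1$ splits. 2. $\mathrm{Stab}(\Gamma)\cong\mu_3(\mathbb F)^2$, where $\mu_3(\mathbb F)$ is the group of cubic roots of $1$ in $\mathbb F$. It is trivial if $\operatorname{char}\mathbb F=3$, or if $\operatorname{char}\mathbb F\ne3$ but $\mathbb F$ does not contain a primitive cubic root of $1$; it is isomorphic to $(\mathbb Z/3)^2$ if $\operatorname{char}\mathbb F\neq 3$ and $\mathbb F$ contains a primitive cubic root of $1$. 3. Let $H$ be the subgroup of $G$ generated by the support of $\Gamma$, and for $\alpha\in\mathbb F^\times$ let $[\alpha]=\alpha(\mathbb F^\times)^3$. There is a well-defined group homomorphism $\Phi_\Gamma:H\to\mathbb F^\times/(\mathbb F^\times)^3$ given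 by $\Phi_\Gamma(e)=[1]$ and $\Phi_\Gamma(h)=[\mathrm n(u,u*u)]$ for $e\ne h\in H$ and any $0\neq u\in\mathcal O_h$ (here $\mathcal O_h\ne0$ and $\mathrm n(u,u*u)\ne0$). One of the following holds: - The image of $\Phi_\Gamma$ is trivial. In this case $(\mathcal O,*,\mathrm n)$ is isomorphic to the split Okubo algebra, $(\mathcal O,\Gamma)\simeq_{\rm eq}(\mathcal O_{1,1},\Gamma_{1,1})$, and $W(\Gamma)$ is isomorphic to the special linear group $\mathrm{SL}(2,3)=\mathrm{SL}_2(\mathbb Z/3)$. - The image of $\Phi_\Gamma$ is cyclic of order $3$. In this case $(\mathcal O,\Gamma)\simeq_{\rm eq}(\mathcal O_{1,\alpha},\Gamma_{1,\alpha})$ for every $\alpha\in\mathbb F^\times$ such that $[\alpha]$ is a generator of the image of $\Phi_\Gamma$, and $W(\Gamma)$ is cyclic of order $3$. - The image of $\Phi_\Gamma$ is isomorphic to $(\mathbb Z/3)^2$. In this case $W(\Gamma)$ is trivial, and for all $\alpha,\beta\in\mathbb F^\times$ such that $[\alpha]$ and $[\beta]$ generate the image of $\Phi_\Gamma$, either $(\mathcal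 O,\Gamma)\simeq_{\rm eq}(\mathcal O_{\alpha,\beta},\Gamma_{\alpha,\beta})$ or $(\mathcal O,\Gamma)\simeq_{\rm eq}(\mathcal O_{\beta,\alpha},\Gamma_{\beta,\alpha})$, but not both. -/

import Mathlib

open scoped TensorProduct

/-! ### The Okubo algebras with parameters `α`, `β` -/

/-- The nonzero elements of `(ℤ/3)²`, which index the basis `z̃_{i,j}`. -/
abbrev OkuboIndex : Type := {a : ZMod 3 × ZMod 3 // a ≠ 0}

/-- The underlying space of `𝒪_{α,β}`: the coordinate vectors with respect to the basis
`z̃_a = z̃_{i,j}`, `a = (i,j) ∈ (ℤ/3)²`, `a ≠ 0`. -/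
def Okubo {F : Type*} [Field F] (_α _β : Fˣ) : Type _ := OkuboIndex → F

/-- The sign in the table of the split algebra: with
`Δ = det (i j; i' j')`, one has `z_{i,j} * z_{i',j'} = okuboSign • z_{i+i',j+j'}`, where the
sign is `0` if `Δ = 2` or `(i,j) + (i',j') = 0`, `-1` if `Δ = 1`, and `1` otherwise. -/
def okuboSign (a b : ZMod 3 × ZMod 3) : ℤ :=
  if a.1 * b.2 - a.2 * b.1 = 2 ∨ a + b = 0 then 0
  else if a.1 * b.2 - a.2 * b.1 = 1 then -1
  else 1

namespace Okubo

variable {F : Type*} [Field F] (α β : Fˣ)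

instance : AddCommGroup (Okubo α β) := inferInstanceAs (AddCommGroup (OkuboIndex → F))

instance : Module F (Okubo α β) := inferInstanceAs (Module F (OkuboIndex → F))

/-- The structure constants of `𝒪_{α,β}`:
`z̃_a * z̃_b = coeff α β a b • z̃_{a+b}`. As `z̃_{i,j} = z_{i,j} ⊗ α^{i/3} β^{j/3}` with
`0 ≤ i, j ≤ 2`, a factor `α` (resp. `β`) appears when the sum of the representatives of the
first (resp. second) indices is at least `3`. -/
def coeff (a b : ZMod 3 × ZMod 3) : F :=
  (okuboSign a b : F) * (α : F) ^ ((a.1.val + b.1.val) / 3) * (β : F) ^ ((a.2.val + b.2.val) / 3)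

/-- The product of `𝒪_{α,β}`, extended bilinearly from the structure constants. -/
instance : Mul (Okubo α β) where
  mul x y := fun c : OkuboIndex =>
    ∑ a : OkuboIndex, ∑ b : OkuboIndex,
      if (a : ZMod 3 × ZMod 3) + b = c then coeff α β a b * x a * y b else 0

theorem mul_apply (x y : Okubo α β) (c : OkuboIndex) :
    (x * y) c = ∑ a : OkuboIndex, ∑ b : OkuboIndex,
      if (a : ZMod 3 × ZMod 3) + b = c then coeff α β a b * x a * y b else 0 := rfl

theorem add_apply (x y : Okubo α β) (c : OkuboIndex) : (x + y) c = x c + y c := rfl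

theorem smul_apply (r : F) (x : Okubo α β) (c : OkuboIndex) : (r • x) c = r * x c := rfl

theorem zero_apply (c : OkuboIndex) : (0 : Okubo α β) c = 0 := rfl

instance : NonUnitalNonAssocRing (Okubo α β) where
  left_distrib x y z := by
    funext c
    simp only [mul_apply, add_apply, ← Finset.sum_add_distrib]
    refine Finset.sum_congr rfl fun a _ => Finset.sum_congr rfl fun b _ => ?_
    split_ifs <;> ring
  right_distrib x y z := by
    funext c
    simp only [mul_apply, add_apply, ← Finset.sum_add_distrib]
    refine Finset.sum_congr rfl fun a _ => Finset.sum_congr rfl fun b _ => ?_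
    split_ifs <;> ring
  zero_mul x := by
    funext c
    simp [mul_apply, zero_apply]
  mul_zero x := by
    funext c
    simp [mul_apply, zero_apply]

instance : IsScalarTower F (Okubo α β) (Okubo α β) where
  smul_assoc r x y := by
    funext c
    simp only [smul_eq_mul, mul_apply, smul_apply, Finset.mul_sum]
    refine Finset.sum_congr rfl fun a _ => Finset.sum_congr rfl fun b _ => ?_
    split_ifs <;> ring

instance : SMulCommClass F (Okubo α β) (Okubo α β) where
  smul_comm r x y := by
    funext c
    simp only [smul_eq_mul, mul_apply, smul_apply, Finset.mul_sum]
    refine Finset.sum_congr rfl fun a _ => Finset.sum_congr rfl fun b _ => ?_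
    split_ifs <;> ring

/-- The coordinate with respect to the basis vector `z̃_a`. -/
def coord (a : OkuboIndex) : Okubo α β →ₗ[F] F where
  toFun x := x a
  map_add' _ _ := rfl
  map_smul' _ _ := rfl

/-- The norm of `𝒪_{α,β}`: every `z̃_a` is isotropic, the polar form vanishes on
`(z̃_a, z̃_b)` unless `a + b = 0`, and it takes the values `α`, `β`, `αβ`, `αβ` on the pairs
`(z̃_{1,0}, z̃_{2,0})`, `(z̃_{0,1}, z̃_{0,2})`, `(z̃_{1,1}, z̃_{2,2})`, `(z̃_{1,2}, z̃_{2,1})`. -/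
def norm : QuadraticForm F (Okubo α β) :=
  (α : F) • QuadraticMap.linMulLin (coord α β ⟨(1, 0), by decide⟩) (coord α β ⟨(2, 0), by decide⟩)
  + (β : F) • QuadraticMap.linMulLin (coord α β ⟨(0, 1), by decide⟩) (coord α β ⟨(0, 2), by decide⟩)
  + ((α : F) * β) •
    QuadraticMap.linMulLin (coord α β ⟨(1, 1), by decide⟩) (coord α β ⟨(2, 2), by decide⟩)
  + ((α : F) * β) •
    QuadraticMap.linMulLin (coord α β ⟨(1, 2), by decide⟩) (coord α β ⟨(2, 1), by decide⟩)

theorem norm_apply (x : Okubo α β) :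
    norm α β x =
      α * (x ⟨(1, 0), by decide⟩ * x ⟨(2, 0), by decide⟩)
      + β * (x ⟨(0, 1), by decide⟩ * x ⟨(0, 2), by decide⟩)
      + α * β * (x ⟨(1, 1), by decide⟩ * x ⟨(2, 2), by decide⟩)
      + α * β * (x ⟨(1, 2), by decide⟩ * x ⟨(2, 1), by decide⟩) := rfl

end Okubo

/-! ### Okubo algebras as twisted forms of the split one -/

/-- A linear bijection between (nonassociative, nonunital) algebras that respects the products,
that is, an isomorphism of algebras. -/
def IsAlgIso {F A B : Type*} [Field F] [NonUnitalNonAssocRing A] [Module F A]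
    [NonUnitalNonAssocRing B] [Module F B] (φ : A ≃ₗ[F] B) : Prop :=
  ∀ x y : A, φ (x * y) = φ x * φ y

/-- `(O, *, n)` is the split Okubo algebra over `F`, that is, `𝒪_{1,1}` with its norm, up to
isomorphism. -/
def IsSplitOkubo {F O : Type*} [Field F] [NonUnitalNonAssocRing O] [Module F O]
    (n : QuadraticForm F O) : Prop :=
  ∃ φ : O ≃ₗ[F] Okubo (1 : Fˣ) 1, IsAlgIso φ ∧ ∀ x : O, Okubo.norm 1 1 (φ x) = n x

/-- `(O, *, n)` is an Okubo algebra over `F`: a twisted form of the split one, that is, after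
extension of scalars to an algebraic closure `K` of `F` it becomes isomorphic to the split Okubo
algebra over `K`, with product and norm. (The extension of `n` to `K ⊗ O` is the quadratic form
over `K` with value `n x` at `1 ⊗ x`, so it is enough to compare norms on these elements, in any
characteristic.) -/
def IsOkubo {F O : Type*} [Field F] [NonUnitalNonAssocRing O] [Module F O]
    [IsScalarTower F O O] [SMulCommClass F O O] (n : QuadraticForm F O) : Prop :=
  ∃ φ : (AlgebraicClosure F ⊗[F] O) ≃ₗ[AlgebraicClosure F] Okubo (1 : (AlgebraicClosure F)ˣ) 1,
    IsAlgIso φ ∧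
      ∀ x : O, Okubo.norm 1 1 (φ (1 ⊗ₜ[F] x)) = algebraMap F (AlgebraicClosure F) (n x)

/-! ### Gradings by abelian groups -/

/-- A grading `A = ⨁_{g ∈ G} A_g`, `A_g A_h ⊆ A_{gh}`, of an algebra by an abelian group. -/
structure AlgGrading (F A G : Type*) [Field F] [NonUnitalNonAssocRing A] [Module F A]
    [CommGroup G] where
  comp : G → Submodule F A
  indep : iSupIndep comp
  iSup_eq_top : ⨆ g, comp g = ⊤
  mul_mem : ∀ {g h : G} {x y : A}, x ∈ comp g → y ∈ comp h → x * y ∈ comp (g * h)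

namespace AlgGrading

section Basic

variable {F A B G H : Type*} [Field F] [NonUnitalNonAssocRing A] [Module F A]
  [NonUnitalNonAssocRing B] [Module F B] [CommGroup G] [CommGroup H]

/-- The support of the grading. -/
def supp (Γ : AlgGrading F A G) : Set G := {g | Γ.comp g ≠ ⊥}

/-- The subgroup generated by the support. -/
def suppSubgroup (Γ : AlgGrading F A G) : Subgroup G := Subgroup.closure Γ.supp

/-- A grading is special if the component of the neutral element is trivial. -/
def IsSpecial (Γ : AlgGrading F A G) : Prop := Γ.comp 1 = ⊥

/-- `φ` is an equivalence from `(A, Γ)` to `(B, Γ')`: an isomorphism of algebras that takes each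
homogeneous component to a homogeneous component. -/
def IsEquivalence (Γ : AlgGrading F A G) (Γ' : AlgGrading F B H) (φ : A ≃ₗ[F] B) : Prop :=
  IsAlgIso φ ∧ ∀ g ∈ Γ.supp, ∃ h : H, (Γ.comp g).map (φ : A →ₗ[F] B) = Γ'.comp h

/-- The graded algebras `(A, Γ)` and `(B, Γ')` are equivalent. -/
def Equivalent (Γ : AlgGrading F A G) (Γ' : AlgGrading F B H) : Prop :=
  ∃ φ : A ≃ₗ[F] B, IsEquivalence Γ Γ' φ

/-- An equivalence reaches each component of the target. -/
theorem IsEquivalence.exists_map_eq {Γ : AlgGrading F A G} {Γ' : AlgGrading F B H}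
    {φ : A ≃ₗ[F] B} (hφ : IsEquivalence Γ Γ' φ) {h : H} (hh : h ∈ Γ'.supp) :
    ∃ g, (Γ.comp g).map (φ : A →ₗ[F] B) = Γ'.comp h := by
  by_contra! hne
  have hle : (⊤ : Submodule F B) ≤ ⨆ (k : H) (_ : k ≠ h), Γ'.comp k := by
    have h1 : (⊤ : Submodule F A).map (φ : A →ₗ[F] B) = ⊤ := by
      rw [Submodule.map_top]
      exact LinearEquiv.range φ
    rw [← h1, ← Γ.iSup_eq_top, Submodule.map_iSup]
    refine iSup_le fun g => ?_
    by_cases hg : g ∈ Γ.supp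
    · obtain ⟨k, hk⟩ := hφ.2 g hg
      have hkh : k ≠ h := by
        rintro rfl
        exact hne g hk
      rw [hk]
      exact le_iSup₂_of_le k hkh le_rfl
    · have : Γ.comp g = ⊥ := by
        by_contra h0
        exact hg h0
      simp [this]
  have hd := Γ'.indep h
  have : Disjoint (Γ'.comp h) ⊤ := hd.mono_right hle
  exact hh (disjoint_top.mp this)

/-- The group `Aut(Γ)` of autoequivalences of `Γ`. -/
def autGroup (Γ : AlgGrading F A G) : Subgroup (A ≃ₗ[F] A) where
  carrier := {φ | IsEquivalence Γ Γ φ}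
  one_mem' := ⟨fun _ _ => rfl, fun g _ => ⟨g, Submodule.map_id _⟩⟩
  mul_mem' := by
    rintro φ ψ hφ hψ
    refine ⟨fun x y => ?_, fun g hg => ?_⟩
    · rw [LinearEquiv.mul_apply, hψ.1, hφ.1]
      rfl
    · obtain ⟨h, hh⟩ := hψ.2 g hg
      have hs : h ∈ Γ.supp := by
        intro h0
        rw [h0] at hh
        exact hg ((Submodule.map_eq_bot_iff (e := ψ)).mp hh)
      obtain ⟨k, hk⟩ := hφ.2 h hs
      refine ⟨k, ?_⟩
      rw [← hk, ← hh, ← Submodule.map_comp]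
      rfl
  inv_mem' := by
    rintro φ hφ
    refine ⟨fun x y => ?_, fun h hh => ?_⟩
    · apply φ.injective
      rw [hφ.1]
      change φ (φ.symm _) = φ (φ.symm _) * φ (φ.symm _)
      simp
    · obtain ⟨g, hg⟩ := hφ.exists_map_eq hh
      refine ⟨g, ?_⟩
      rw [← hg, ← Submodule.map_comp]
      convert Submodule.map_id _
      ext x
      exact φ.symm_apply_apply x

/-- The subgroup `Stab(Γ)` of `Aut(Γ)` of the automorphisms that fix each homogeneous
component. -/
def stabGroup (Γ : AlgGrading F A G) : Subgroup Γ.autGroup where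
  carrier := {φ | ∀ g, (Γ.comp g).map ((φ : A ≃ₗ[F] A) : A →ₗ[F] A) = Γ.comp g}
  one_mem' := fun _ => Submodule.map_id _
  mul_mem' := by
    rintro φ ψ hφ hψ g
    have h1 := hφ g
    nth_rewrite 1 [← hψ g] at h1
    rw [← Submodule.map_comp] at h1
    exact h1
  inv_mem' := by
    rintro φ hφ g
    have h1 := hφ g
    nth_rewrite 1 [← h1]
    rw [← Submodule.map_comp]
    convert Submodule.map_id _
    ext x
    exact (φ : A ≃ₗ[F] A).symm_apply_apply x

instance stabGroup_normal (Γ : AlgGrading F A G) : Γ.stabGroup.Normal where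
  conj_mem := by
    rintro ψ hψ φ h
    by_cases hh : h ∈ Γ.supp
    · obtain ⟨g, hg⟩ := φ.2.exists_map_eq hh
      have h1 := hψ g
      rw [← hg]
      nth_rewrite 2 [← h1]
      rw [← Submodule.map_comp, ← Submodule.map_comp]
      congr 1
      ext x
      change (φ : A ≃ₗ[F] A) ((ψ : A ≃ₗ[F] A) ((φ : A ≃ₗ[F] A).symm ((φ : A ≃ₗ[F] A) x))) = _
      rw [LinearEquiv.symm_apply_apply]
      rfl
    · have : Γ.comp h = ⊥ := by
        by_contra h0
        exact hh h0
      simp [this]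

/-- The Weyl group `W(Γ) = Aut(Γ) / Stab(Γ)`. -/
abbrev weylGroup (Γ : AlgGrading F A G) : Type _ := Γ.autGroup ⧸ Γ.stabGroup

/-- The short exact sequence `1 → Stab(Γ) → Aut(Γ) → W(Γ) → 1` splits. -/
def WeylSequenceSplits (Γ : AlgGrading F A G) : Prop :=
  ∃ s : Γ.weylGroup →* Γ.autGroup,
    (QuotientGroup.mk' Γ.stabGroup).comp s = MonoidHom.id Γ.weylGroup

end Basic

end AlgGrading

/-- The canonical `(ℤ/3)²`-grading `Γ_{α,β}` on `𝒪_{α,β}`, with `deg z̃_a = a`: the component of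
degree `g` consists of the vectors whose coordinates outside `g` vanish. -/
def Okubo.grading {F : Type*} [Field F] (α β : Fˣ) :
    AlgGrading F (Okubo α β) (Multiplicative (ZMod 3 × ZMod 3)) where
  comp g :=
    { carrier := {x | ∀ a : OkuboIndex, Multiplicative.ofAdd (a : ZMod 3 × ZMod 3) ≠ g → x a = 0}
      add_mem' := fun {x y} hx hy a ha => by
        rw [Okubo.add_apply, hx a ha, hy a ha, add_zero]
      zero_mem' := fun _ _ => rfl
      smul_mem' := fun r x hx a ha => by
        rw [Okubo.smul_apply, hx a ha, mul_zero] }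
  indep := by
    intro g
    let N : Submodule F (Okubo α β) :=
      { carrier := {x | ∀ a : OkuboIndex,
          Multiplicative.ofAdd (a : ZMod 3 × ZMod 3) = g → x a = 0}
        add_mem' := fun {x y} hx hy a ha => by
          rw [Okubo.add_apply, hx a ha, hy a ha, add_zero]
        zero_mem' := fun _ _ => rfl
        smul_mem' := fun r x hx a ha => by
          rw [Okubo.smul_apply, hx a ha, mul_zero] }
    refine Disjoint.mono_right (c := N) (iSup₂_le fun h hh x hx a ha => ?_) ?_
    · exact hx a (fun h' => hh (h'.symm.trans ha))
    · rw [Submodule.disjoint_def]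
      intro x hx hx'
      funext a
      by_cases ha : Multiplicative.ofAdd (a : ZMod 3 × ZMod 3) = g
      · exact hx' a ha
      · exact hx a ha
  iSup_eq_top := by
    rw [eq_top_iff]
    intro x _
    have hx : x = ∑ a : OkuboIndex, (Pi.single a (x a) : OkuboIndex → F) :=
      (Finset.univ_sum_single (x : OkuboIndex → F)).symm
    rw [hx]
    refine Submodule.sum_mem _ fun a _ => ?_
    refine Submodule.mem_iSup_of_mem (Multiplicative.ofAdd (a : ZMod 3 × ZMod 3)) ?_
    intro b hb
    refine Pi.single_eq_of_ne (fun hba => hb ?_) _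
    rw [hba]
  mul_mem := by
    intro g h x y hx hy c hc
    rw [Okubo.mul_apply]
    refine Finset.sum_eq_zero fun a _ => Finset.sum_eq_zero fun b _ => ?_
    split_ifs with hab
    · by_cases ha : Multiplicative.ofAdd (a : ZMod 3 × ZMod 3) = g
      · by_cases hb : Multiplicative.ofAdd (b : ZMod 3 × ZMod 3) = h
        · exact absurd (by rw [← hab, ofAdd_add, ha, hb]) hc
        · rw [hy b hb, mul_zero]
      · rw [hx a ha, mul_zero, zero_mul]
    · rfl

/-! ### The map `Φ_Γ` -/

/-- The group `F^× / (F^×)³` of cube classes. -/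
abbrev CubeClasses (F : Type*) [Field F] : Type _ := Fˣ ⧸ (powMonoidHom 3 : Fˣ →* Fˣ).range

/-- The cube class `[α]` of `α ∈ F^×`. -/
def cubeClass {F : Type*} [Field F] (α : Fˣ) : CubeClasses F := QuotientGroup.mk α

/-- `Φ` is the homomorphism `Φ_Γ : H → F^× / (F^×)³`, where `H` is the subgroup generated by the
support: `Φ_Γ(e) = [1]`, and, for `e ≠ h ∈ H`, the component `O_h` is nonzero and
`Φ_Γ(h) = [n(u, u * u)]` for every nonzero `u ∈ O_h`, where `n(·,·)` is the polar form
(in particular these values of the polar form are nonzero). These conditions determine `Φ`. -/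
structure IsPhi {F O G : Type*} [Field F] [NonUnitalNonAssocRing O] [Module F O] [CommGroup G]
    (n : QuadraticForm F O) (Γ : AlgGrading F O G) (Φ : Γ.suppSubgroup →* CubeClasses F) :
    Prop where
  exists_ne_zero : ∀ h : Γ.suppSubgroup, h ≠ 1 → ∃ u ∈ Γ.comp (h : G), u ≠ 0
  map_eq : ∀ h : Γ.suppSubgroup, h ≠ 1 → ∀ u ∈ Γ.comp (h : G), u ≠ 0 →
    ∃ hu : QuadraticMap.polar n u (u * u) ≠ 0, Φ h = cubeClass (Units.mk0 _ hu)

/-! An Okubo algebra satisfies `(x*y)*x = n(x)y = x*(y*x)` with an associative nondegenerate polar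
form, because these identities descend from the split algebra over the algebraic closure
(`IsOkubo.isSymComp`). Together with dimension 8 (`IsOkubo.finrank_eq`) this is all that is used
about `O`.

In a special grading, the polar form pairs the component of degree `g` only with that of degree
`g⁻¹`, and products landing in degree `1` vanish. The linearized identities then show that
homogeneous elements are isotropic, that `x*x` and `n(x, x*x)` are nonzero for homogeneous `x ≠ 0`,
that degrees in the support have trivial cube, and that components have dimension at most one
(`IsSpecial.exists_eq_smul`). For nonzero homogeneous `x`, `y` in independent degrees exactly one of
`x*y`, `y*x` is nonzero. Ordering them so that `y*x = 0`, the whole multiplication table is forced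
by `α = n(x, x*x)` and `β = n(y, y*y)` (`IsSpecial.table_det_one`), so that `O` with its grading is
`𝒪_{α,β}` with `Γ_{α,β}` (`IsSpecial.exists_okuboCoords`).

In these coordinates `Φ` is `(i,j) ↦ [α]^i[β]^j`, as seen from the fourth power of a homogeneous
element. An equivalence preserves cube classes (`Okubo.exists_map_z`) and the determinant of degrees
(`Okubo.det_eq_one`), since the sign of a product detects the orientation. Conversely, a change of
coordinates by a matrix of determinant one realizes any parameters that `Φ` allows
(`OkuboCoords.nonempty_of_cubeHom`). According to the order 1, 3 or 9 of the image, the parameters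
become `(1,1)`, `(1,γ)` or `(γ,δ)` up to order. The matrices of `SL₂(ℤ/3)` that preserve `Φ` are
then all of them, the shears, or the identity alone; they act by permuting basis vectors, which both
computes the Weyl group and splits the sequence. The stabilizer consists of the diagonal maps given
by characters of `(ℤ/3)²`. -/

/-- The identities of a symmetric composition algebra with nondegenerate norm. -/
structure IsSymComp {F O : Type*} [Field F] [NonUnitalNonAssocRing O] [Module F O]
    (n : QuadraticForm F O) : Prop where
  mul_mul_self : ∀ x y : O, (x * y) * x = n x • y
  self_mul_mul : ∀ x y : O, x * (y * x) = n x • y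
  polar_assoc : ∀ x y z : O, QuadraticMap.polar n (x * y) z = QuadraticMap.polar n x (y * z)
  nondeg : ∀ x : O, (∀ y, QuadraticMap.polar n x y = 0) → x = 0

/-! ### The split Okubo algebra in coordinates. -/

namespace Okubo

variable {F : Type*} [Field F]

theorem forall_index {p : OkuboIndex → Prop} :
    (∀ a, p a) ↔ p ⟨(0, 1), by decide⟩ ∧ p ⟨(0, 2), by decide⟩ ∧ p ⟨(1, 0), by decide⟩
      ∧ p ⟨(1, 1), by decide⟩ ∧ p ⟨(1, 2), by decide⟩ ∧ p ⟨(2, 0), by decide⟩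
      ∧ p ⟨(2, 1), by decide⟩ ∧ p ⟨(2, 2), by decide⟩ := by
  refine ⟨fun h => ⟨h _, h _, h _, h _, h _, h _, h _, h _⟩, ?_⟩
  rintro ⟨h1, h2, h3, h4, h5, h6, h7, h8⟩ ⟨⟨i, j⟩, hij⟩
  fin_cases i <;> fin_cases j <;> first | exact absurd rfl hij | assumption

/-- The index condition and the sign are kept together as one integer, so that which terms survive
can be decided independently of `F`. -/
theorem mul_one_one_apply (x y : Okubo (1 : Fˣ) 1) (c : OkuboIndex) :
    (x * y) c = ∑ a : OkuboIndex, ∑ b : OkuboIndex,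
      ((if (a : ZMod 3 × ZMod 3) + b = c then okuboSign a b else 0 : ℤ) : F) * (x a * y b) := by
  rw [mul_apply]
  refine Finset.sum_congr rfl fun a _ => Finset.sum_congr rfl fun b _ => ?_
  split_ifs <;> simp [coeff, mul_assoc]

theorem mul_one_one_eq (x y : Okubo (1 : Fˣ) 1) (c : OkuboIndex)
    (t : Finset (OkuboIndex × OkuboIndex))
    (ht : ∀ p : OkuboIndex × OkuboIndex, p ∉ t →
      (if (p.1 : ZMod 3 × ZMod 3) + p.2 = c then okuboSign p.1 p.2 else 0) = 0) :
    (x * y) c = ∑ p ∈ t,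
      ((if (p.1 : ZMod 3 × ZMod 3) + p.2 = c then okuboSign p.1 p.2 else 0 : ℤ) : F)
        * (x p.1 * y p.2) := by
  rw [mul_one_one_apply, ← Fintype.sum_prod_type']
  refine (Finset.sum_subset (Finset.subset_univ _) fun p _ hp => ?_).symm
  rw [ht p hp]; simp

/-- The product of the split Okubo algebra, in coordinates. -/
theorem mul_one_one_coord (x y : Okubo (1 : Fˣ) 1) (c d a a' b b' e e' : OkuboIndex)
    (hd : (d : ZMod 3 × ZMod 3) + d = c ∧ okuboSign d d = 1 := by decide)
    (h₁ : (a : ZMod 3 × ZMod 3) + a' = c ∧ okuboSign a a' = -1 := by decide)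
    (h₂ : (b : ZMod 3 × ZMod 3) + b' = c ∧ okuboSign b b' = -1 := by decide)
    (h₃ : (e : ZMod 3 × ZMod 3) + e' = c ∧ okuboSign e e' = -1 := by decide)
    (hne : d ≠ a ∧ d ≠ b ∧ d ≠ e ∧ a ≠ b ∧ a ≠ e ∧ b ≠ e := by decide)
    (ht : ∀ p : OkuboIndex × OkuboIndex,
      p ∉ ({(d, d), (a, a'), (b, b'), (e, e')} : Finset (OkuboIndex × OkuboIndex)) →
      (if (p.1 : ZMod 3 × ZMod 3) + p.2 = c then okuboSign p.1 p.2 else 0) = 0 := by decide) :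
    (x * y) c = x d * y d - x a * y a' - x b * y b' - x e * y e' := by
  obtain ⟨n1, n2, n3, n4, n5, n6⟩ := hne
  rw [mul_one_one_eq x y c _ ht, Finset.sum_insert (by simp [n1, n2, n3]),
    Finset.sum_insert (by simp [n4, n5]), Finset.sum_insert (by simp [n6]), Finset.sum_singleton]
  simp only [hd.1, hd.2, h₁.1, h₁.2, h₂.1, h₂.2, h₃.1, h₃.2, if_true]
  push_cast
  ring

/-- Coordinate `c` receives a square from `2c`, because `2c + 2c = c`, and one product from each of
the three `a` with determinant `1` against `c`, with second index `c - a`. -/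
theorem mul_one_one_01 (x y : Okubo (1 : Fˣ) 1) :
    (x * y) ⟨(0, 1), by decide⟩ = x ⟨(0, 2), by decide⟩ * y ⟨(0, 2), by decide⟩
      - x ⟨(1, 0), by decide⟩ * y ⟨(2, 1), by decide⟩
      - x ⟨(1, 1), by decide⟩ * y ⟨(2, 0), by decide⟩
      - x ⟨(1, 2), by decide⟩ * y ⟨(2, 2), by decide⟩ :=
  mul_one_one_coord x y _ _ _ _ _ _ _ _

theorem mul_one_one_02 (x y : Okubo (1 : Fˣ) 1) :
    (x * y) ⟨(0, 2), by decide⟩ = x ⟨(0, 1), by decide⟩ * y ⟨(0, 1), by decide⟩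
      - x ⟨(2, 0), by decide⟩ * y ⟨(1, 2), by decide⟩
      - x ⟨(2, 1), by decide⟩ * y ⟨(1, 1), by decide⟩
      - x ⟨(2, 2), by decide⟩ * y ⟨(1, 0), by decide⟩ :=
  mul_one_one_coord x y _ _ _ _ _ _ _ _

theorem mul_one_one_10 (x y : Okubo (1 : Fˣ) 1) :
    (x * y) ⟨(1, 0), by decide⟩ = x ⟨(2, 0), by decide⟩ * y ⟨(2, 0), by decide⟩
      - x ⟨(0, 2), by decide⟩ * y ⟨(1, 1), by decide⟩
      - x ⟨(1, 2), by decide⟩ * y ⟨(0, 1), by decide⟩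
      - x ⟨(2, 2), by decide⟩ * y ⟨(2, 1), by decide⟩ :=
  mul_one_one_coord x y _ _ _ _ _ _ _ _

theorem mul_one_one_11 (x y : Okubo (1 : Fˣ) 1) :
    (x * y) ⟨(1, 1), by decide⟩ = x ⟨(2, 2), by decide⟩ * y ⟨(2, 2), by decide⟩
      - x ⟨(0, 2), by decide⟩ * y ⟨(1, 2), by decide⟩
      - x ⟨(1, 0), by decide⟩ * y ⟨(0, 1), by decide⟩
      - x ⟨(2, 1), by decide⟩ * y ⟨(2, 0), by decide⟩ :=
  mul_one_one_coord x y _ _ _ _ _ _ _ _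

theorem mul_one_one_12 (x y : Okubo (1 : Fˣ) 1) :
    (x * y) ⟨(1, 2), by decide⟩ = x ⟨(2, 1), by decide⟩ * y ⟨(2, 1), by decide⟩
      - x ⟨(0, 2), by decide⟩ * y ⟨(1, 0), by decide⟩
      - x ⟨(1, 1), by decide⟩ * y ⟨(0, 1), by decide⟩
      - x ⟨(2, 0), by decide⟩ * y ⟨(2, 2), by decide⟩ :=
  mul_one_one_coord x y _ _ _ _ _ _ _ _

theorem mul_one_one_20 (x y : Okubo (1 : Fˣ) 1) :
    (x * y) ⟨(2, 0), by decide⟩ = x ⟨(1, 0), by decide⟩ * y ⟨(1, 0), by decide⟩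
      - x ⟨(0, 1), by decide⟩ * y ⟨(2, 2), by decide⟩
      - x ⟨(1, 1), by decide⟩ * y ⟨(1, 2), by decide⟩
      - x ⟨(2, 1), by decide⟩ * y ⟨(0, 2), by decide⟩ :=
  mul_one_one_coord x y _ _ _ _ _ _ _ _

theorem mul_one_one_21 (x y : Okubo (1 : Fˣ) 1) :
    (x * y) ⟨(2, 1), by decide⟩ = x ⟨(1, 2), by decide⟩ * y ⟨(1, 2), by decide⟩
      - x ⟨(0, 1), by decide⟩ * y ⟨(2, 0), by decide⟩
      - x ⟨(1, 0), by decide⟩ * y ⟨(1, 1), by decide⟩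
      - x ⟨(2, 2), by decide⟩ * y ⟨(0, 2), by decide⟩ :=
  mul_one_one_coord x y _ _ _ _ _ _ _ _

theorem mul_one_one_22 (x y : Okubo (1 : Fˣ) 1) :
    (x * y) ⟨(2, 2), by decide⟩ = x ⟨(1, 1), by decide⟩ * y ⟨(1, 1), by decide⟩
      - x ⟨(0, 1), by decide⟩ * y ⟨(2, 1), by decide⟩
      - x ⟨(1, 2), by decide⟩ * y ⟨(1, 0), by decide⟩
      - x ⟨(2, 0), by decide⟩ * y ⟨(0, 2), by decide⟩ :=
  mul_one_one_coord x y _ _ _ _ _ _ _ _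

theorem polar_norm (α β : Fˣ) (x y : Okubo α β) :
    QuadraticMap.polar (norm α β) x y =
      α * (x ⟨(1, 0), by decide⟩ * y ⟨(2, 0), by decide⟩
        + y ⟨(1, 0), by decide⟩ * x ⟨(2, 0), by decide⟩)
      + β * (x ⟨(0, 1), by decide⟩ * y ⟨(0, 2), by decide⟩
        + y ⟨(0, 1), by decide⟩ * x ⟨(0, 2), by decide⟩)
      + α * β * (x ⟨(1, 1), by decide⟩ * y ⟨(2, 2), by decide⟩
        + y ⟨(1, 1), by decide⟩ * x ⟨(2, 2), by decide⟩)
      + α * β * (x ⟨(1, 2), by decide⟩ * y ⟨(2, 1), by decide⟩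
        + y ⟨(1, 2), by decide⟩ * x ⟨(2, 1), by decide⟩) := by
  simp only [QuadraticMap.polar, norm_apply, add_apply]
  ring

/-- The basis vector `z̃_a` of `𝒪_{α,β}`; it is `0` for `a = 0`. -/
def z (α β : Fˣ) (a : ZMod 3 × ZMod 3) : Okubo α β :=
  fun b => if (b : ZMod 3 × ZMod 3) = a then 1 else 0

theorem z_apply (α β : Fˣ) (a : ZMod 3 × ZMod 3) (b : OkuboIndex) :
    z α β a b = if (b : ZMod 3 × ZMod 3) = a then 1 else 0 := rfl

/-- In coordinates the identities are polynomial with integer coefficients, so a formal verification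
covers every characteristic. -/
theorem isSymComp_one_one : IsSymComp (norm (1 : Fˣ) 1) where
  mul_mul_self x y := by
    refine funext (forall_index.2 ?_)
    simp only [mul_one_one_01, mul_one_one_02, mul_one_one_10, mul_one_one_11,
      mul_one_one_12, mul_one_one_20, mul_one_one_21, mul_one_one_22, smul_apply, norm_apply, Units.val_one]
    refine ⟨?_, ?_, ?_, ?_, ?_, ?_, ?_, ?_⟩ <;> ring
  self_mul_mul x y := by
    refine funext (forall_index.2 ?_)
    simp only [mul_one_one_01, mul_one_one_02, mul_one_one_10, mul_one_one_11,
      mul_one_one_12, mul_one_one_20, mul_one_one_21, mul_one_one_22, smul_apply, norm_apply, Units.val_one]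
    refine ⟨?_, ?_, ?_, ?_, ?_, ?_, ?_, ?_⟩ <;> ring
  polar_assoc x y z := by
    simp only [polar_norm, mul_one_one_01, mul_one_one_02, mul_one_one_10, mul_one_one_11,
      mul_one_one_12, mul_one_one_20, mul_one_one_21, mul_one_one_22, Units.val_one]
    ring
  nondeg x h := by
    have key : ∀ c : OkuboIndex, QuadraticMap.polar (norm (1 : Fˣ) 1) x (z 1 1 c) = 0 :=
      fun c => h _
    simp only [polar_norm, Units.val_one, z_apply] at key
    have key := forall_index.1 key
    simp +decide only [if_true, if_false, mul_zero, zero_mul, mul_one, one_mul, add_zero,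
      zero_add] at key
    obtain ⟨h1, h2, h3, h4, h5, h6, h7, h8⟩ := key
    refine funext (forall_index.2 ⟨?_, ?_, ?_, ?_, ?_, ?_, ?_, ?_⟩) <;> assumption

end Okubo

/-! ### Descent from the algebraic closure. -/

section BaseChange

variable {F O : Type*} [Field F] [NonUnitalNonAssocRing O] [Module F O]
    [IsScalarTower F O O] [SMulCommClass F O O]

theorem IsOkubo.finrank_eq {n : QuadraticForm F O} (hO : IsOkubo n) : Module.finrank F O = 8 := by
  obtain ⟨φ, -, -⟩ := hO
  rw [← Module.finrank_baseChange (R := AlgebraicClosure F), φ.finrank_eq]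
  refine (Module.finrank_fintype_fun_eq_card (AlgebraicClosure F) (η := OkuboIndex)).trans ?_
  decide

/-- The identities of symmetric composition algebras descend from the split Okubo algebra over
the algebraic closure. -/
theorem IsOkubo.isSymComp {n : QuadraticForm F O} (hO : IsOkubo n) : IsSymComp n := by
  obtain ⟨φ, hφ, hn⟩ := hO
  let K := AlgebraicClosure F
  have hS := Okubo.isSymComp_one_one (F := K)
  -- `O` embeds in the split algebra over `K` compatibly with product and norm, so identities may be
  -- checked on the image.
  let ι : O → Okubo (1 : Kˣ) 1 := fun x => φ (1 ⊗ₜ[F] x)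
  have hinj : Function.Injective ι := by
    refine φ.injective.comp ?_
    exact Module.Flat.tensorProduct_mk_injective F O K
  have hmul : ∀ x y, ι (x * y) = ι x * ι y := by
    intro x y
    rw [← hφ, Algebra.TensorProduct.tmul_mul_tmul, one_mul]
  have hadd : ∀ x y, ι (x + y) = ι x + ι y := by
    intro x y
    simp only [ι, TensorProduct.tmul_add, map_add]
  have hsmul : ∀ (r : F) x, ι (r • x) = algebraMap F K r • ι x := by
    intro r x
    simp only [ι, TensorProduct.tmul_smul, ← map_smul]
    congr 1
    rw [algebraMap_smul]
  have hpol : ∀ x y, QuadraticMap.polar (Okubo.norm (1 : Kˣ) 1) (ι x) (ι y) =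
      algebraMap F K (QuadraticMap.polar n x y) := by
    intro x y
    simp only [QuadraticMap.polar, ← hadd, map_sub]
    rw [hn, hn, hn]
  refine ⟨fun x y => hinj ?_, fun x y => hinj ?_, fun x y z => ?_, fun x hx => hinj ?_⟩
  · rw [hmul, hmul, hsmul, hS.mul_mul_self, hn]
  · rw [hmul, hmul, hsmul, hS.self_mul_mul, hn]
  · apply (algebraMap F K).injective
    rw [← hpol, ← hpol, hmul, hmul, hS.polar_assoc]
  · have h0 : ι 0 = 0 := by simp [ι]
    rw [h0]
    refine hS.nondeg _ fun y => ?_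
    -- Nondegeneracy over `K` tests against all of `K ⊗ O`; by additivity and `K`-linearity, vectors
    -- `1 ⊗ y` suffice.
    obtain ⟨t, rfl⟩ := φ.surjective y
    induction t with
    | zero => simp
    | add s t hs ht => rw [map_add, QuadraticMap.polar_add_right, hs, ht, add_zero]
    | tmul k y =>
      have : k ⊗ₜ[F] y = k • ((1 : K) ⊗ₜ[F] y) := by
        rw [TensorProduct.smul_tmul', smul_eq_mul, mul_one]
      rw [this, map_smul, QuadraticMap.polar_smul_right]
      change k • QuadraticMap.polar _ (ι x) (ι y) = 0
      rw [hpol, hx, map_zero, smul_zero]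

end BaseChange

/-! ### Special gradings on symmetric composition algebras. -/

open QuadraticMap

namespace IsSymComp

variable {F O : Type*} [Field F] [NonUnitalNonAssocRing O] [Module F O]
  {n : QuadraticForm F O}

/-- The linearization of `(x * y) * x = n(x) y`. -/
theorem mul_mul_add (hn : IsSymComp n) (x y w : O) :
    (x * y) * w + (w * y) * x = polar n x w • y := by
  have h := hn.mul_mul_self (x + w) y
  simp only [add_mul, mul_add] at h
  rw [hn.mul_mul_self x y, hn.mul_mul_self w y] at h
  simp only [polar, sub_smul]
  rw [← h]
  abel

/-- The linearization of `x * (y * x) = n(x) y`. -/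
theorem mul_mul_add' (hn : IsSymComp n) (x y w : O) :
    x * (y * w) + w * (y * x) = polar n x w • y := by
  have h := hn.self_mul_mul (x + w) y
  simp only [add_mul, mul_add] at h
  rw [hn.self_mul_mul x y, hn.self_mul_mul w y] at h
  simp only [polar, sub_smul]
  rw [← h]
  abel

end IsSymComp

namespace AlgGrading

variable {F O G : Type*} [Field F] [NonUnitalNonAssocRing O] [Module F O]
  [CommGroup G] {Γ : AlgGrading F O G}

theorem eq_zero_of_mem {g h : G} (hgh : g ≠ h) {x : O} (hg : x ∈ Γ.comp g) (hh : x ∈ Γ.comp h) :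
    x = 0 :=
  (Submodule.disjoint_def.1 (Γ.indep.pairwiseDisjoint hgh)) x hg hh

theorem exists_mem_of_forall [Nontrivial O] (Γ : AlgGrading F O G) :
    ∃ g, ∃ x ∈ Γ.comp g, x ≠ 0 := by
  by_contra! h
  have : (⊤ : Submodule F O) ≤ ⊥ := by
    rw [← Γ.iSup_eq_top]
    exact iSup_le fun g x hx => h g x hx
  exact bot_ne_top (le_antisymm bot_le this)

variable {n : QuadraticForm F O}

/-- For `w ≠ 0` of degree `c`, the linearized identity writes `n(x,y) w` as a sum of elements of
degree `abc`. As `ab ≠ 1`, this degree differs from `c`. -/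
theorem polar_eq_zero (hn : IsSymComp n) {a b : G} (hab : a * b ≠ 1) {x y : O}
    (hx : x ∈ Γ.comp a) (hy : y ∈ Γ.comp b) : polar n x y = 0 := by
  rcases subsingleton_or_nontrivial O with hO | hO
  · rw [Subsingleton.elim x 0, polar_zero_left]
  obtain ⟨c, w, hw, hw0⟩ := Γ.exists_mem_of_forall
  have h1 : polar n x y • w ∈ Γ.comp (a * b * c) := by
    rw [← hn.mul_mul_add x w y]
    refine add_mem ?_ ?_
    · convert Γ.mul_mem (Γ.mul_mem hx hw) hy using 2
      rw [mul_right_comm]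
    · convert Γ.mul_mem (Γ.mul_mem hy hw) hx using 2
      rw [mul_comm a b, mul_right_comm]
  have h2 := eq_zero_of_mem (g := a * b * c) (h := c) (by simpa using hab) h1
    (Submodule.smul_mem _ _ hw)
  exact (smul_eq_zero.1 h2).resolve_right hw0

theorem exists_polar_ne_zero (hn : IsSymComp n) {a : G} {x : O}
    (hx : x ∈ Γ.comp a) (hx0 : x ≠ 0) : ∃ y ∈ Γ.comp a⁻¹, polar n x y ≠ 0 := by
  by_contra! h
  refine hx0 (hn.nondeg x fun y => ?_)
  have hle : (⊤ : Submodule F O) ≤ LinearMap.ker (n.polarBilin x) := by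
    rw [← Γ.iSup_eq_top]
    refine iSup_le fun g y hy => ?_
    rw [LinearMap.mem_ker, QuadraticMap.polarBilin_apply_apply]
    by_cases hg : a * g = 1
    · exact h y (by rwa [inv_eq_of_mul_eq_one_right hg])
    · exact polar_eq_zero hn hg hx hy
  exact hle (Submodule.mem_top (x := y))

/-- Orthogonality kills the right-hand side of the linearized identity, so outer factors may be
exchanged up to sign. This and its mirror image are the main rewriting rules for the multiplication
table. -/
theorem mul_mul_eq_neg (hn : IsSymComp n) {a b : G} (hab : a * b ≠ 1) {u w : O} (hu : u ∈ Γ.comp a)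
    (hw : w ∈ Γ.comp b) (v : O) : (u * v) * w = -((w * v) * u) := by
  rw [eq_neg_iff_add_eq_zero, hn.mul_mul_add, polar_eq_zero hn hab hu hw, zero_smul]

theorem mul_mul_eq_neg' (hn : IsSymComp n) {a b : G} (hab : a * b ≠ 1) {u w : O} (hu : u ∈ Γ.comp a)
    (hw : w ∈ Γ.comp b) (v : O) : u * (v * w) = -(w * (v * u)) := by
  rw [eq_neg_iff_add_eq_zero, hn.mul_mul_add', polar_eq_zero hn hab hu hw, zero_smul]

section Special

theorem IsSpecial.mul_eq_zero (hΓ : Γ.IsSpecial) {a b : G} (hab : a * b = 1) {x y : O}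
    (hx : x ∈ Γ.comp a) (hy : y ∈ Γ.comp b) : x * y = 0 := by
  have h := Γ.mul_mem hx hy
  rw [hab] at h
  rw [IsSpecial] at hΓ
  rw [hΓ] at h
  exact (Submodule.mem_bot F).1 h

variable (hn : IsSymComp n) (hΓ : Γ.IsSpecial)
include hn hΓ

/-- Choose `y` in the inverse degree with `n(x,y) ≠ 0`. Then `x*y = 0` by speciality, so `n(x) y =
(x*y)*x = 0`. -/
theorem IsSpecial.norm_eq_zero {a : G} {x : O} (hx : x ∈ Γ.comp a) : n x = 0 := by
  by_cases hx0 : x = 0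
  · rw [hx0, map_zero]
  obtain ⟨y, hy, hxy⟩ := exists_polar_ne_zero hn hx hx0
  have h := hn.mul_mul_self x y
  rw [hΓ.mul_eq_zero (mul_inv_cancel a) hx hy, zero_mul] at h
  refine (smul_eq_zero.1 h.symm).resolve_right ?_
  rintro rfl
  exact hxy (polar_zero_right (Q := n) x)

theorem IsSpecial.mul_mul_self {a : G} {x : O} (hx : x ∈ Γ.comp a) (y : O) : (x * y) * x = 0 := by
  rw [hn.mul_mul_self, hΓ.norm_eq_zero hn hx, zero_smul]

theorem IsSpecial.self_mul_mul {a : G} {x : O} (hx : x ∈ Γ.comp a) (y : O) : x * (y * x) = 0 := by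
  rw [hn.self_mul_mul, hΓ.norm_eq_zero hn hx, zero_smul]

/-- With `y` of inverse degree, `y*x = 0` reduces the linearized identity to `(x*x)*y = n(x,y) x`.
-/
theorem IsSpecial.mul_self_ne_zero {a : G} {x : O} (hx : x ∈ Γ.comp a) (hx0 : x ≠ 0) :
    x * x ≠ 0 := by
  obtain ⟨y, hy, hxy⟩ := exists_polar_ne_zero hn hx hx0
  have h := hn.mul_mul_add x x y
  rw [hΓ.mul_eq_zero (inv_mul_cancel a) hy hx, zero_mul, add_zero] at h
  intro h0
  rw [h0, zero_mul] at h
  exact (smul_ne_zero hxy hx0) h.symm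

/-- The fourth power of a homogeneous element. -/
theorem IsSpecial.quartic {a : G} {x : O} (hx : x ∈ Γ.comp a) :
    (x * x) * (x * x) = polar n x (x * x) • x := by
  have h := hn.mul_mul_add x x (x * x)
  rwa [hΓ.mul_mul_self hn hx, zero_mul, add_zero] at h

/-- The fourth power is the square of the nonzero homogeneous element `x*x`, hence nonzero. -/
theorem IsSpecial.cubic_ne_zero {a : G} {x : O} (hx : x ∈ Γ.comp a) (hx0 : x ≠ 0) :
    polar n x (x * x) ≠ 0 := by
  intro h
  have h1 := hΓ.quartic hn hx
  rw [h, zero_smul] at h1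
  exact hΓ.mul_self_ne_zero hn (Γ.mul_mem hx hx) (hΓ.mul_self_ne_zero hn hx hx0) h1

theorem IsSpecial.mul_mul_eq_one {a : G} {x : O} (hx : x ∈ Γ.comp a) (hx0 : x ≠ 0) :
    a * (a * a) = 1 := by
  by_contra h
  exact hΓ.cubic_ne_zero hn hx hx0 (polar_eq_zero hn h hx (Γ.mul_mem hx hx))

/-- If both products vanished, so would both terms of `(x*y)*(x*x) + ((x*x)*y)*x = n(x, x*x) y`,
since `(x*x)*y = -((y*x)*x)`. -/
theorem IsSpecial.mul_ne_zero_or {a b : G} (hab : a * b ≠ 1) {x y : O} (hx : x ∈ Γ.comp a)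
    (hy : y ∈ Γ.comp b) (hx0 : x ≠ 0) (hy0 : y ≠ 0) : x * y ≠ 0 ∨ y * x ≠ 0 := by
  by_contra! h
  have h1 := hn.mul_mul_add x y (x * x)
  rw [h.1, zero_mul, zero_add, mul_mul_eq_neg hn hab hx hy, h.2, zero_mul, neg_zero,
    zero_mul] at h1
  exact smul_ne_zero (hΓ.cubic_ne_zero hn hx hx0) hy0 h1.symm

variable [IsScalarTower F O O] [SMulCommClass F O O]

/-- The components of a special grading have dimension at most one. -/
theorem IsSpecial.exists_eq_smul {b : G} {u v : O} (hu : u ∈ Γ.comp b) (hu0 : u ≠ 0)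
    (hv : v ∈ Γ.comp b) : ∃ c : F, v = c • u := by
  have hb := hΓ.mul_mul_eq_one hn hu hu0
  have hg := hΓ.cubic_ne_zero hn hu hu0
  set γ := polar n u (u * u) with hγ
  refine ⟨γ⁻¹ * polar n v (u * u), ?_⟩
  rw [← sub_eq_zero]
  -- Subtract from `v` its multiple of `u` so that the rest `y` is orthogonal to `u*u`; the claim is
  -- `y = 0`.
  set y := v - (γ⁻¹ * polar n v (u * u)) • u with hy
  have hyb : y ∈ Γ.comp b := sub_mem hv (Submodule.smul_mem _ _ hu)
  have huu := Γ.mul_mem hu hu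
  have hyy := Γ.mul_mem hyb hyb
  have hyu : polar n y (u * u) = 0 := by
    rw [hy, polar_sub_left, polar_smul_left, ← hγ, smul_eq_mul]
    field_simp
    ring
  have hyuu : y * (u * u) = 0 := hΓ.mul_eq_zero hb hyb huu
  have huuy : (u * u) * y = 0 := hΓ.mul_eq_zero (by rwa [mul_comm]) huu hyb
  have hquartic := hΓ.quartic hn hu
  rw [← hγ] at hquartic
  -- `γ u` is the square of `u*u`, so linearizing at `u*u` and `y` expresses `γ (u*y)` through terms
  -- that vanish.
  have h1 : u * y = 0 := by
    have h := hn.mul_mul_add (u * u) (u * u) y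
    rw [hquartic, hyuu, zero_mul, add_zero, polar_comm, hyu, zero_smul, smul_mul_assoc] at h
    exact (smul_eq_zero.1 h).resolve_left hg
  have h2 : y * u = 0 := by
    have h := hn.mul_mul_add' y (u * u) (u * u)
    rw [hquartic, huuy, mul_zero, add_zero, hyu, zero_smul, mul_smul_comm] at h
    exact (smul_eq_zero.1 h).resolve_left hg
  have h3 : ∀ {p q : O}, p ∈ Γ.comp b → q ∈ Γ.comp b → p * q = 0 →
      (p * p) * (q * q) = 0 ∧ polar n p (q * q) = 0 := by
    intro p q hp hq hpq
    have hpol : polar n p (q * q) = 0 := by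
      rw [← hn.polar_assoc, hpq, polar_zero_left]
    have h := hn.mul_mul_add p p (q * q)
    rw [hΓ.mul_eq_zero (by rwa [mul_comm]) (Γ.mul_mem hq hq) hp, zero_mul, add_zero, hpol,
      zero_smul] at h
    exact ⟨h, hpol⟩
  -- The mixed terms are gone, so the fourth power of `u + y` is `γ u + n(y, y*y) y`, while the
  -- quartic identity gives `(γ + n(y, y*y))(u + y)`. Comparison leaves `γ y = -n(y, y*y) u`, and
  -- pairing with `u*u` forces both sides to be zero.
  have h4 := hΓ.quartic hn (add_mem hu hyb)
  have h5 : (u + y) * (u + y) = u * u + y * y := by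
    rw [add_mul, mul_add, mul_add, h1, h2, add_zero, zero_add]
  rw [h5, add_mul, mul_add, mul_add, (h3 hu hyb h1).1, (h3 hyb hu h2).1, hquartic,
    hΓ.quartic hn hyb, polar_add_left, polar_add_right, polar_add_right, (h3 hu hyb h1).2, hyu,
    ← hγ, add_zero, zero_add, add_zero, zero_add, smul_add, add_smul, add_smul] at h4
  have h6 : γ • y = -(polar n y (y * y) • u) := by
    rw [eq_neg_iff_add_eq_zero]
    have : γ • u + polar n y (y * y) • u + (γ • y + polar n y (y * y) • y)
      - (γ • u + polar n y (y * y) • y) = 0 := by rw [← h4, sub_self]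
    rw [← this]
    abel
  have h7 : polar n y (y * y) = 0 := by
    have h := congrArg (fun w => polar n w (u * u)) h6
    simp only [polar_smul_left, polar_neg_left, hyu, ← hγ, smul_eq_mul, mul_zero] at h
    exact (_root_.mul_eq_zero.1 (neg_eq_zero.1 h.symm)).resolve_right hg
  rw [h7, zero_smul, neg_zero] at h6
  exact (smul_eq_zero.1 h6).resolve_left hg

/-- Both products lie in one line, so `y*x` is a multiple of `x*y`, and exchanging outer factors
gives `(x*x)*y = 0`. The mirror rule then kills `y*((x*x)*(x*x))`, a nonzero multiple of `y*x`. The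
hypothesis `a ≠ b` is what makes `a²b ≠ 1`. -/
theorem IsSpecial.mul_eq_zero_of_mul_ne_zero {a b : G} (hab : a * b ≠ 1) (hne : a ≠ b) {x y : O}
    (hx : x ∈ Γ.comp a) (hy : y ∈ Γ.comp b) (hxy : x * y ≠ 0) : y * x = 0 := by
  have hx0 : x ≠ 0 := by
    rintro rfl
    exact hxy (zero_mul _)
  have ha := hΓ.mul_mul_eq_one hn hx hx0
  have hyx := Γ.mul_mem hy hx
  rw [mul_comm] at hyx
  obtain ⟨c, hc⟩ := hΓ.exists_eq_smul hn (Γ.mul_mem hx hy) hxy hyx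
  have h1 : (x * x) * y = 0 := by
    rw [mul_mul_eq_neg hn hab hx hy, hc, smul_mul_assoc, hΓ.mul_mul_self hn hx, smul_zero, neg_zero]
  have h2 : (a * a) * b ≠ 1 := by
    intro h
    rw [← ha, mul_comm a (a * a)] at h
    exact hne (mul_left_cancel h).symm
  have h3 := mul_mul_eq_neg' hn (by rwa [mul_comm]) hy (Γ.mul_mem hx hx) (x * x)
  rw [h1, mul_zero, neg_zero, hΓ.quartic hn hx, mul_smul_comm] at h3
  exact (smul_eq_zero.1 h3).resolve_left (hΓ.cubic_ne_zero hn hx hx0)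

end Special

end AlgGrading

/-! ### The multiplication table forced by two homogeneous elements. -/

/-- The family with which a pair of homogeneous elements spans an algebra `𝒪_{α,β}`. -/
def okuboFamily {O : Type*} [NonUnitalNonAssocRing O] (x y : O) (c : ZMod 3 × ZMod 3) : O :=
  (![![0, y, y * y], ![x, -(x * y), -((y * y) * x)],
    ![x * x, -(y * (x * x)), -((x * x) * (y * y))]] : Matrix (Fin 3) (Fin 3) O) c.1 c.2

namespace Okubo

theorem coeff_of_det_eq_one {F : Type*} [Field F] (α β : Fˣ) {a b : ZMod 3 × ZMod 3}
    (h : a.1 * b.2 - a.2 * b.1 = 1) :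
    coeff α β a b =
      -((α : F) ^ ((a.1.val + b.1.val) / 3) * (β : F) ^ ((a.2.val + b.2.val) / 3)) := by
  have h1 : okuboSign a b = -1 := by
    revert a b; decide
  rw [coeff, h1]
  push_cast
  ring

end Okubo

namespace AlgGrading

variable {F O G : Type*} [Field F] [NonUnitalNonAssocRing O] [Module F O]
  [IsScalarTower F O O] [SMulCommClass F O O] [CommGroup G] {Γ : AlgGrading F O G}
  {n : QuadraticForm F O}

/-- Each product reduces to known ones by exchanging outer factors. When the degrees of the outer
factors are inverse, the exchange produces an extra scalar `α` or `β`, and the remaining term dies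
because of `y*x = 0`. Injectivity of `f` turns the conditions on degrees into decidable ones on
`(ℤ/3)²`. -/
theorem IsSpecial.table_det_one (hn : IsSymComp n) (hΓ : Γ.IsSpecial)
    (f : Multiplicative (ZMod 3 × ZMod 3) →* G) (hf : Function.Injective f) {x y : O}
    (hx : x ∈ Γ.comp (f (.ofAdd (1, 0)))) (hy : y ∈ Γ.comp (f (.ofAdd (0, 1))))
    (hyx : y * x = 0) (α β : Fˣ) (hα : polar n x (x * x) = α) (hβ : polar n y (y * y) = β)
    (a b : OkuboIndex) :
    (a.1.1 * b.1.2 - a.1.2 * b.1.1 = 1 →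
      okuboFamily x y a * okuboFamily x y b = -((α : F) ^ ((a.1.1.val + b.1.1.val) / 3)
        * (β : F) ^ ((a.1.2.val + b.1.2.val) / 3)) • okuboFamily x y (a + b)) ∧
    okuboFamily x y a * okuboFamily x y a = ((α : F) ^ ((a.1.1.val + a.1.1.val) / 3)
        * (β : F) ^ ((a.1.2.val + a.1.2.val) / 3)) • okuboFamily x y (a + a) := by
  have ne_one : ∀ {c d : ZMod 3 × ZMod 3}, c + d ≠ 0 →
      f (.ofAdd c) * f (.ofAdd d) ≠ 1 := by
    intro c d hcd h
    rw [← map_mul, ← ofAdd_add, map_eq_one_iff f hf] at h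
    exact hcd h
  have A : ∀ {c d : ZMod 3 × ZMod 3} {u w : O}, c + d ≠ 0 → u ∈ Γ.comp (f (.ofAdd c)) →
      w ∈ Γ.comp (f (.ofAdd d)) → ∀ v, (u * v) * w = -((w * v) * u) :=
    fun h hu hw v => mul_mul_eq_neg hn (ne_one h) hu hw v
  have B : ∀ {c d : ZMod 3 × ZMod 3} {u w : O}, c + d ≠ 0 → u ∈ Γ.comp (f (.ofAdd c)) →
      w ∈ Γ.comp (f (.ofAdd d)) → ∀ v, u * (v * w) = -(w * (v * u)) :=
    fun h hu hw v => mul_mul_eq_neg' hn (ne_one h) hu hw v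
  have M : ∀ {c d : ZMod 3 × ZMod 3} {u w : O}, u ∈ Γ.comp (f (.ofAdd c)) →
      w ∈ Γ.comp (f (.ofAdd d)) → u * w ∈ Γ.comp (f (.ofAdd (c + d))) := by
    intro c d u w hu hw
    rw [ofAdd_add, map_mul]
    exact Γ.mul_mem hu hw
  have XX := hΓ.quartic hn hx
  have YY := hΓ.quartic hn hy
  rw [hα] at XX
  rw [hβ] at YY
  -- Opaque names for the six other members: `X`, `Y`, `P`, `R`, `Q`, `T` have degrees `(2,0)`,
  -- `(0,2)`, `(1,1)`, `(1,2)`, `(2,1)`, `(2,2)`.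
  obtain ⟨X, dX⟩ : ∃ X, X = x * x := ⟨_, rfl⟩
  obtain ⟨Y, dY⟩ : ∃ Y, Y = y * y := ⟨_, rfl⟩
  obtain ⟨P, dP⟩ : ∃ P, P = -(x * y) := ⟨_, rfl⟩
  obtain ⟨R, dR⟩ : ∃ R, R = -(Y * x) := ⟨_, rfl⟩
  obtain ⟨Q, dQ⟩ : ∃ Q, Q = -(y * X) := ⟨_, rfl⟩
  obtain ⟨T, dT⟩ : ∃ T, T = -(X * Y) := ⟨_, rfl⟩
  have hX : X ∈ Γ.comp (f (.ofAdd (2, 0))) := by rw [dX]; exact M hx hx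
  have hY : Y ∈ Γ.comp (f (.ofAdd (0, 2))) := by rw [dY]; exact M hy hy
  have hP : P ∈ Γ.comp (f (.ofAdd (1, 1))) := by rw [dP]; exact neg_mem (M hx hy)
  have hR : R ∈ Γ.comp (f (.ofAdd (1, 2))) := by rw [dR]; exact neg_mem (M hY hx)
  have hQ : Q ∈ Γ.comp (f (.ofAdd (2, 1))) := by rw [dQ]; exact neg_mem (M hy hX)
  have hT : T ∈ Γ.comp (f (.ofAdd (2, 2))) := by rw [dT]; exact neg_mem (M hX hY)
  rw [← dX] at XX hα
  rw [← dY] at YY hβ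
  -- The vanishing of `y*x` propagates to the squares of `x` and `y`, in the matching orientations.
  have Xy : X * y = 0 := by
    rw [dX, A (by decide) hx hy, hyx, zero_mul, neg_zero]
  have xY : x * Y = 0 := by
    rw [dY, B (by decide) hx hy, hyx, mul_zero, neg_zero]
  have YX : Y * X = 0 := by
    rw [dY, A (by decide) hy hX, Xy, zero_mul, neg_zero]
  have xy : x * y = -P := by rw [dP, neg_neg]
  have Yx : Y * x = -R := by rw [dR, neg_neg]
  have yX : y * X = -Q := by rw [dQ, neg_neg]
  have XY : X * Y = -T := by rw [dT, neg_neg]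
  have β0 : (β : F) ≠ 0 := β.ne_zero
  have α0 : (α : F) ≠ 0 := α.ne_zero
  have addA : ∀ u v w, (u * v) * w = polar n u w • v - (w * v) * u :=
    fun u v w => eq_sub_of_add_eq (hn.mul_mul_add u v w)
  have addB : ∀ u v w, u * (v * w) = polar n u w • v - w * (v * u) :=
    fun u v w => eq_sub_of_add_eq (hn.mul_mul_add' u v w)
  have hα' : polar n X x = α := by rw [polar_comm, hα]
  have hβ' : polar n Y y = β := by rw [polar_comm, hβ]
  have xP : x * P = -Q := by
    rw [dP, mul_neg, B (by decide) hx hy, neg_neg, ← dX, yX]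
  have xQ : x * Q = -((α : F) • y) := by
    rw [dQ, mul_neg, addB, hyx, mul_zero, sub_zero, hα]
  have XR : X * R = -((α : F) • Y) := by
    rw [dR, mul_neg, addB, YX, mul_zero, sub_zero, hα']
  have XT : X * T = -((α : F) • R) := by
    rw [dT, mul_neg, B (by decide) hX hY, XX, mul_smul_comm, Yx, smul_neg, neg_neg]
  have yQ : y * Q = -T := by
    rw [dQ, mul_neg, B (by decide) hy hX, neg_neg, ← dY, XY]
  have yT : y * T = -((β : F) • X) := by
    rw [dT, mul_neg, addB, Xy, mul_zero, sub_zero, hβ]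
  have YP : Y * P = -((β : F) • x) := by
    rw [dP, mul_neg, addB, xY, mul_zero, sub_zero, hβ']
  have YR : Y * R = -((β : F) • P) := by
    rw [dR, mul_neg, B (by decide) hY hx, YY, mul_smul_comm, xy, smul_neg, neg_neg]
  have Py : P * y = -R := by
    rw [dP, neg_mul, A (by decide) hx hy, neg_neg, ← dY, Yx]
  have Rx : R * x = -T := by
    rw [dR, neg_mul, A (by decide) hY hx, neg_neg, ← dX, XY]
  have PP : P * P = T := by
    nth_rewrite 1 [dP]
    rw [neg_mul, A (by decide) hx hP, neg_neg, Py, neg_mul, Rx, neg_neg]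
  have PR : P * R = -((β : F) • X) := by
    rw [← neg_neg R, ← Py, mul_neg, B (by decide) hP hy, neg_neg, PP, yT]
  have PX : P * X = -((α : F) • y) := by
    rw [dP, neg_mul, addA, Xy, zero_mul, sub_zero, hα]
  have TY : T * Y = -((β : F) • Q) := by
    rw [dT, neg_mul, A (by decide) hX hY, YY, smul_mul_assoc, yX, smul_neg, neg_neg]
  have Tx : T * x = -((α : F) • Y) := by
    rw [dT, neg_mul, addA, xY, zero_mul, sub_zero, hα']
  -- Here `T = P*P`, so the quartic identity gives `n(P, T) P`, and `n(P, T) = -n(x, y*T) = β n(x,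
  -- X) = αβ`.
  have TT : T * T = ((α : F) * β) • P := by
    nth_rewrite 1 2 [← PP]
    rw [hΓ.quartic hn hP, PP]
    congr 1
    nth_rewrite 1 [dP]
    rw [polar_neg_left, hn.polar_assoc, yT, polar_neg_right, polar_smul_right, hα, smul_eq_mul,
      neg_neg, mul_comm]
  -- `Q` is available as a right factor only through `T*Y = -βQ`; the factor `β` is cancelled at the
  -- end.
  have TQ : T * Q = -(((α : F) * β) • x) := by
    have h : (β : F) • (T * Q) = -(T * (T * Y)) := by
      rw [TY, mul_neg, neg_neg, mul_smul_comm]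
    rw [B (by decide) hT hY, neg_neg, TT, mul_smul_comm, YP] at h
    apply smul_right_injective O β0
    simp only [h, smul_neg, smul_smul]
    congr 2; ring
  have Ry : R * y = -((β : F) • x) := by
    rw [dR, neg_mul, addA, hyx, zero_mul, sub_zero, hβ']
  have RR : R * R = (β : F) • Q := by
    nth_rewrite 1 [dR]
    rw [neg_mul, A (by decide) hY hR, neg_neg, Rx, neg_mul, TY, neg_neg]
  have RT : R * T = -(((α : F) * β) • y) := by
    rw [← neg_neg T, ← Rx, mul_neg, B (by decide) hR hx, neg_neg, RR, mul_smul_comm, xQ, smul_neg,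
      smul_smul, mul_comm]
  have QY : Q * Y = -((β : F) • X) := by
    rw [dQ, neg_mul, addA, YX, zero_mul, sub_zero, hβ]
  have QX : Q * X = -((α : F) • P) := by
    rw [dQ, neg_mul, A (by decide) hy hX, neg_neg, XX, smul_mul_assoc, xy, smul_neg]
  have QQ : Q * Q = (α : F) • R := by
    nth_rewrite 1 [dQ]
    rw [neg_mul, A (by decide) hy hQ, neg_neg, QX, neg_mul, smul_mul_assoc, Py, smul_neg, neg_neg]
  have QP : Q * P = -((α : F) • Y) := by
    have h : (α : F) • (Q * P) = -(Q * (Q * X)) := by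
      rw [QX, mul_neg, neg_neg, mul_smul_comm]
    rw [B (by decide) hQ hX, neg_neg, QQ, mul_smul_comm, XR] at h
    exact smul_right_injective O α0 h
  have e01 : okuboFamily x y (0, 1) = y := rfl
  have e02 : okuboFamily x y (0, 2) = Y := dY.symm
  have e10 : okuboFamily x y (1, 0) = x := rfl
  have e11 : okuboFamily x y (1, 1) = P := dP.symm
  have e12 : okuboFamily x y (1, 2) = R := by rw [dR, dY]; rfl
  have e20 : okuboFamily x y (2, 0) = X := dX.symm
  have e21 : okuboFamily x y (2, 1) = Q := by rw [dQ, dX]; rfl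
  have e22 : okuboFamily x y (2, 2) = T := by rw [dT, dX, dY]; rfl
  have E1 : ∀ {a b : ZMod 3 × ZMod 3} (c : ZMod 3 × ZMod 3) (p q : ℕ), a + b = c →
      (a.1.val + b.1.val) / 3 = p →
      (a.2.val + b.2.val) / 3 = q →
      okuboFamily x y a * okuboFamily x y b = -((α : F) ^ p * (β : F) ^ q) • okuboFamily x y c →
      a.1 * b.2 - a.2 * b.1 = 1 →
      okuboFamily x y a * okuboFamily x y b = -((α : F) ^ ((a.1.val + b.1.val) / 3)
        * (β : F) ^ ((a.2.val + b.2.val) / 3)) • okuboFamily x y (a + b) := by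
    rintro a b c p q rfl rfl rfl h -
    exact h
  have E2 : ∀ {a : ZMod 3 × ZMod 3} (c : ZMod 3 × ZMod 3) (p q : ℕ), a + a = c →
      (a.1.val + a.1.val) / 3 = p →
      (a.2.val + a.2.val) / 3 = q →
      okuboFamily x y a * okuboFamily x y a = ((α : F) ^ p * (β : F) ^ q) • okuboFamily x y c →
      okuboFamily x y a * okuboFamily x y a = ((α : F) ^ ((a.1.val + a.1.val) / 3)
        * (β : F) ^ ((a.2.val + a.2.val) / 3)) • okuboFamily x y (a + a) := by
    rintro a c p q rfl rfl rfl h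
    exact h
  refine ⟨?_, ?_⟩
  · revert a b
    refine Okubo.forall_index.2 ⟨?_, ?_, ?_, ?_, ?_, ?_, ?_, ?_⟩
    · exact Okubo.forall_index.2 ⟨fun h => absurd h (by decide),
        fun h => absurd h (by decide),
        fun h => absurd h (by decide),
        fun h => absurd h (by decide),
        fun h => absurd h (by decide),
        E1 (2, 1) 0 0 rfl rfl rfl (by simp [e01, e20, e21, yX]),
        E1 (2, 2) 0 0 rfl rfl rfl (by simp [e01, e21, e22, yQ]),
        E1 (2, 0) 0 1 rfl rfl rfl (by simp [e01, e22, e20, yT])⟩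
    · exact Okubo.forall_index.2 ⟨fun h => absurd h (by decide),
        fun h => absurd h (by decide),
        E1 (1, 2) 0 0 rfl rfl rfl (by simp [e02, e10, e12, Yx]),
        E1 (1, 0) 0 1 rfl rfl rfl (by simp [e02, e11, e10, YP]),
        E1 (1, 1) 0 1 rfl rfl rfl (by simp [e02, e12, e11, YR]),
        fun h => absurd h (by decide),
        fun h => absurd h (by decide),
        fun h => absurd h (by decide)⟩
    · exact Okubo.forall_index.2 ⟨E1 (1, 1) 0 0 rfl rfl rfl (by simp [e10, e01, e11, xy]),
        fun h => absurd h (by decide),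
        fun h => absurd h (by decide),
        E1 (2, 1) 0 0 rfl rfl rfl (by simp [e10, e11, e21, xP]),
        fun h => absurd h (by decide),
        fun h => absurd h (by decide),
        E1 (0, 1) 1 0 rfl rfl rfl (by simp [e10, e21, e01, xQ]),
        fun h => absurd h (by decide)⟩
    · exact Okubo.forall_index.2 ⟨E1 (1, 2) 0 0 rfl rfl rfl (by simp [e11, e01, e12, Py]),
        fun h => absurd h (by decide),
        fun h => absurd h (by decide),
        fun h => absurd h (by decide),
        E1 (2, 0) 0 1 rfl rfl rfl (by simp [e11, e12, e20, PR]),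
        E1 (0, 1) 1 0 rfl rfl rfl (by simp [e11, e20, e01, PX]),
        fun h => absurd h (by decide),
        fun h => absurd h (by decide)⟩
    · exact Okubo.forall_index.2 ⟨E1 (1, 0) 0 1 rfl rfl rfl (by simp [e12, e01, e10, Ry]),
        fun h => absurd h (by decide),
        E1 (2, 2) 0 0 rfl rfl rfl (by simp [e12, e10, e22, Rx]),
        fun h => absurd h (by decide),
        fun h => absurd h (by decide),
        fun h => absurd h (by decide),
        fun h => absurd h (by decide),
        E1 (0, 1) 1 1 rfl rfl rfl (by simp [e12, e22, e01, RT])⟩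
    · exact Okubo.forall_index.2 ⟨fun h => absurd h (by decide),
        E1 (2, 2) 0 0 rfl rfl rfl (by simp [e20, e02, e22, XY]),
        fun h => absurd h (by decide),
        fun h => absurd h (by decide),
        E1 (0, 2) 1 0 rfl rfl rfl (by simp [e20, e12, e02, XR]),
        fun h => absurd h (by decide),
        fun h => absurd h (by decide),
        E1 (1, 2) 1 0 rfl rfl rfl (by simp [e20, e22, e12, XT])⟩
    · exact Okubo.forall_index.2 ⟨fun h => absurd h (by decide),
        E1 (2, 0) 0 1 rfl rfl rfl (by simp [e21, e02, e20, QY]),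
        fun h => absurd h (by decide),
        E1 (0, 2) 1 0 rfl rfl rfl (by simp [e21, e11, e02, QP]),
        fun h => absurd h (by decide),
        E1 (1, 1) 1 0 rfl rfl rfl (by simp [e21, e20, e11, QX]),
        fun h => absurd h (by decide),
        fun h => absurd h (by decide)⟩
    · exact Okubo.forall_index.2 ⟨fun h => absurd h (by decide),
        E1 (2, 1) 0 1 rfl rfl rfl (by simp [e22, e02, e21, TY]),
        E1 (0, 2) 1 0 rfl rfl rfl (by simp [e22, e10, e02, Tx]),
        fun h => absurd h (by decide),
        fun h => absurd h (by decide),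
        fun h => absurd h (by decide),
        E1 (1, 0) 1 1 rfl rfl rfl (by simp [e22, e21, e10, TQ]),
        fun h => absurd h (by decide)⟩
  · revert a
    exact Okubo.forall_index.2 ⟨E2 (0, 2) 0 0 rfl rfl rfl (by simp [e01, e02, ← dY]),
      E2 (0, 1) 0 1 rfl rfl rfl (by simp [e02, e01, YY]),
      E2 (2, 0) 0 0 rfl rfl rfl (by simp [e10, e20, ← dX]),
      E2 (2, 2) 0 0 rfl rfl rfl (by simp [e11, e22, PP]),
      E2 (2, 1) 0 1 rfl rfl rfl (by simp [e12, e21, RR]),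
      E2 (1, 0) 1 0 rfl rfl rfl (by simp [e20, e10, XX]),
      E2 (1, 2) 1 0 rfl rfl rfl (by simp [e21, e12, QQ]),
      E2 (1, 1) 1 1 rfl rfl rfl (by simp [e22, e11, TT])⟩

end AlgGrading

/-! ### Basis vectors and graded coordinates. -/

namespace Okubo

section Basis

variable {F : Type*} [Field F] {α β : Fˣ}

theorem z_ne_zero (a : OkuboIndex) : z α β a ≠ 0 := by
  intro h
  have h1 := congrFun h a
  rw [z_apply, if_pos rfl] at h1
  exact one_ne_zero h1

theorem eq_sum (x : Okubo α β) : x = ∑ a : OkuboIndex, x a • z α β a := by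
  have h : (x : OkuboIndex → F) = ∑ a, Pi.single a (x a) := (Finset.univ_sum_single x).symm
  refine Eq.trans h (Finset.sum_congr rfl fun a _ => ?_)
  funext b
  rw [smul_apply, z_apply, Pi.single_apply]
  simp only [Subtype.ext_iff, mul_ite, mul_one, mul_zero]

theorem z_mul_z (a b : OkuboIndex) :
    z α β a * z α β b = coeff α β a b • z α β ((a : ZMod 3 × ZMod 3) + b) := by
  funext c
  rw [mul_apply, Finset.sum_eq_single a, Finset.sum_eq_single b]
  · simp only [z_apply, smul_apply, if_true, mul_one, eq_comm (a := (c : ZMod 3 × ZMod 3)),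
      mul_ite, mul_zero]
  · intro b' _ hb
    rw [z_apply α β b, if_neg (fun h => hb (Subtype.ext h)), mul_zero, ite_self]
  · simp
  · intro a' _ ha
    refine Finset.sum_eq_zero fun b' _ => ?_
    rw [z_apply α β a, if_neg (fun h => ha (Subtype.ext h)), mul_zero, zero_mul, ite_self]
  · simp

/-- A linear map on `𝒪_{α,β}` is multiplicative if it is so on the basis vectors. -/
theorem map_mul_of_z {A : Type*} [NonUnitalNonAssocRing A] [Module F A] [IsScalarTower F A A]
    [SMulCommClass F A A] (T : Okubo α β →ₗ[F] A)
    (hT : ∀ a b : OkuboIndex, T (z α β a * z α β b) = T (z α β a) * T (z α β b))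
    (x y : Okubo α β) : T (x * y) = T x * T y := by
  rw [eq_sum x, eq_sum y]
  simp only [Finset.sum_mul_sum, map_sum, map_smul, smul_mul_assoc, mul_smul_comm, hT]

theorem mem_comp_iff (a : OkuboIndex) (x : Okubo α β) :
    x ∈ (grading α β).comp (.ofAdd a) ↔ ∃ k : F, x = k • z α β a := by
  constructor
  · intro h
    refine ⟨x a, funext fun b => ?_⟩
    rw [smul_apply, z_apply]
    split_ifs with hb
    · rw [mul_one, Subtype.ext hb]
    · rw [mul_zero]
      exact h b (fun h' => hb (Multiplicative.ofAdd.injective h'))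
  · rintro ⟨k, rfl⟩ b hb
    rw [smul_apply, z_apply, if_neg (fun h => hb (congrArg _ h)), mul_zero]

theorem z_mem_comp (a : OkuboIndex) : z α β a ∈ (grading α β).comp (.ofAdd a) :=
  (mem_comp_iff a _).2 ⟨1, (one_smul F _).symm⟩

theorem grading_isSpecial (α β : Fˣ) : (grading α β).IsSpecial := by
  refine (Submodule.eq_bot_iff _).2 fun x hx => funext fun a => hx a ?_
  intro h
  exact a.2 (Multiplicative.ofAdd.injective h)

end Basis

end Okubo

/-- An isomorphism of `O` with `𝒪_{α,β}` that identifies the grading `Γ` with `Γ_{α,β}` up to an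
embedding of `(ℤ/3)²` into the grading group. -/
structure OkuboCoords {F O G : Type*} [Field F] [NonUnitalNonAssocRing O] [Module F O]
    [CommGroup G] (Γ : AlgGrading F O G) (α β : Fˣ) where
  toEquiv : O ≃ₗ[F] Okubo α β
  isAlgIso : IsAlgIso toEquiv
  deg : Multiplicative (ZMod 3 × ZMod 3) →* G
  deg_injective : Function.Injective deg
  map_comp : ∀ c, (Γ.comp (deg c)).map (toEquiv : O →ₗ[F] Okubo α β) = (Okubo.grading α β).comp c

namespace AlgGrading

variable {F O G : Type*} [Field F] [NonUnitalNonAssocRing O] [Module F O]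
  [CommGroup G] {Γ : AlgGrading F O G}
  {n : QuadraticForm F O}

theorem okuboFamily_mem (f : Multiplicative (ZMod 3 × ZMod 3) →* G) {x y : O}
    (hx : x ∈ Γ.comp (f (.ofAdd (1, 0)))) (hy : y ∈ Γ.comp (f (.ofAdd (0, 1)))) (a : OkuboIndex) :
    okuboFamily x y a ∈ Γ.comp (f (.ofAdd a)) := by
  have M : ∀ {c d : ZMod 3 × ZMod 3} {u w : O}, u ∈ Γ.comp (f (.ofAdd c)) →
      w ∈ Γ.comp (f (.ofAdd d)) → u * w ∈ Γ.comp (f (.ofAdd (c + d))) := by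
    intro c d u w hu hw
    rw [ofAdd_add, map_mul]
    exact Γ.mul_mem hu hw
  revert a
  exact Okubo.forall_index.2 ⟨hy, M hy hy, hx, neg_mem (M hx hy), neg_mem (M (M hy hy) hx),
    M hx hx, neg_mem (M hy (M hx hx)), neg_mem (M (M hx hx) (M hy hy))⟩

variable [IsScalarTower F O O] [SMulCommClass F O O]

/-- Four members are `x`, `y` and their squares. Each other member is the left factor of a product
of determinant one whose value is a nonzero multiple of one of these four. -/
theorem IsSpecial.okuboFamily_ne_zero (hn : IsSymComp n) (hΓ : Γ.IsSpecial)
    (f : Multiplicative (ZMod 3 × ZMod 3) →* G) (hf : Function.Injective f) {x y : O}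
    (hx : x ∈ Γ.comp (f (.ofAdd (1, 0)))) (hy : y ∈ Γ.comp (f (.ofAdd (0, 1))))
    (hyx : y * x = 0) (α β : Fˣ) (hα : polar n x (x * x) = α) (hβ : polar n y (y * y) = β)
    (a : OkuboIndex) : okuboFamily x y a ≠ 0 := by
  have hx0 : x ≠ 0 := by
    rintro rfl
    exact α.ne_zero (by rw [← hα, polar_zero_left])
  have hy0 : y ≠ 0 := by
    rintro rfl
    exact β.ne_zero (by rw [← hβ, polar_zero_left])
  have hxx := hΓ.mul_self_ne_zero hn hx hx0
  have hyy := hΓ.mul_self_ne_zero hn hy hy0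
  have key : ∀ a b c : OkuboIndex, a.1.1 * b.1.2 - a.1.2 * b.1.1 = 1 →
      (a : ZMod 3 × ZMod 3) + b = c →
      okuboFamily x y c ≠ 0 → okuboFamily x y a ≠ 0 := by
    intro a b c hab habc hc h
    have h1 := (hΓ.table_det_one hn f hf hx hy hyx α β hα hβ a b).1 hab
    rw [h, zero_mul, habc] at h1
    refine smul_ne_zero ?_ hc h1.symm
    exact neg_ne_zero.2 (mul_ne_zero (pow_ne_zero _ α.ne_zero) (pow_ne_zero _ β.ne_zero))
  revert a
  exact Okubo.forall_index.2 ⟨hy0, hyy, hx0,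
    key _ ⟨(2, 0), by decide⟩ ⟨(0, 1), by decide⟩ (by decide) (by decide) hy0,
    key _ ⟨(0, 1), by decide⟩ ⟨(1, 0), by decide⟩ (by decide) (by decide) hx0, hxx,
    key _ ⟨(0, 2), by decide⟩ ⟨(2, 0), by decide⟩ (by decide) (by decide) hxx,
    key _ ⟨(1, 0), by decide⟩ ⟨(0, 2), by decide⟩ (by decide) (by decide) hyy⟩

/-- The multiplication table of `𝒪_{α,β}`. -/
theorem IsSpecial.okuboFamily_mul (hn : IsSymComp n) (hΓ : Γ.IsSpecial)
    (f : Multiplicative (ZMod 3 × ZMod 3) →* G) (hf : Function.Injective f) {x y : O}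
    (hx : x ∈ Γ.comp (f (.ofAdd (1, 0)))) (hy : y ∈ Γ.comp (f (.ofAdd (0, 1))))
    (hyx : y * x = 0) (α β : Fˣ) (hα : polar n x (x * x) = α) (hβ : polar n y (y * y) = β)
    (a b : OkuboIndex) : okuboFamily x y a * okuboFamily x y b =
      Okubo.coeff α β a b • okuboFamily x y ((a : ZMod 3 × ZMod 3) + b) := by
  have hma := okuboFamily_mem f hx hy a
  have hmb := okuboFamily_mem f hx hy b
  have ne_one : ∀ {c d : ZMod 3 × ZMod 3}, c + d ≠ 0 →
      f (.ofAdd c) * f (.ofAdd d) ≠ 1 := by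
    intro c d hcd h
    rw [← map_mul, ← ofAdd_add, map_eq_one_iff f hf] at h
    exact hcd h
  by_cases h0 : (a : ZMod 3 × ZMod 3) + b = 0
  · have : okuboSign a b = 0 := by simp [okuboSign, h0]
    rw [Okubo.coeff, this, Int.cast_zero, zero_mul, zero_mul, zero_smul]
    refine hΓ.mul_eq_zero ?_ hma hmb
    rw [← map_mul, ← ofAdd_add, h0, ofAdd_zero, map_one]
  -- Determinant `1` is in the table. With determinant `2` the reversed pair has determinant `1` and
  -- nonzero product, so this product vanishes. Determinant `0` with nonzero sum leaves only
  -- squares.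
  have hcases : ∀ a b : OkuboIndex, (a : ZMod 3 × ZMod 3) + b ≠ 0 →
      (a.1.1 * b.1.2 - a.1.2 * b.1.1 = 1) ∨
      (a.1.1 * b.1.2 - a.1.2 * b.1.1 = 2 ∧ b.1.1 * a.1.2 - b.1.2 * a.1.1 = 1 ∧ b ≠ a) ∨
      (a = b ∧ okuboSign a b = 1) := by decide
  rcases hcases a b h0 with h | ⟨h, h', hne⟩ | ⟨rfl, h⟩
  · rw [(hΓ.table_det_one hn f hf hx hy hyx α β hα hβ a b).1 h, Okubo.coeff_of_det_eq_one _ _ h]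
  · have : okuboSign a b = 0 := by rw [okuboSign, if_pos (Or.inl h)]
    rw [Okubo.coeff, this, Int.cast_zero, zero_mul, zero_mul, zero_smul]
    rw [add_comm] at h0
    refine hΓ.mul_eq_zero_of_mul_ne_zero hn (ne_one h0) ?_ hmb hma ?_
    · exact fun h => hne (Subtype.ext (Multiplicative.ofAdd.injective (hf h)))
    · rw [(hΓ.table_det_one hn f hf hx hy hyx α β hα hβ b a).1 h']
      refine smul_ne_zero ?_ (hΓ.okuboFamily_ne_zero hn f hf hx hy hyx α β hα hβ ⟨_, h0⟩)
      exact neg_ne_zero.2 (mul_ne_zero (pow_ne_zero _ α.ne_zero) (pow_ne_zero _ β.ne_zero))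
  · rw [(hΓ.table_det_one hn f hf hx hy hyx α β hα hβ a a).2, Okubo.coeff, h, Int.cast_one, one_mul]

/-- Eight nonzero vectors in distinct degrees are independent, hence a basis by dimension. The table
makes the coordinate map multiplicative, and one-dimensionality of components makes it graded. -/
theorem IsSpecial.nonempty_okuboCoords (hn : IsSymComp n) (hdim : Module.finrank F O = 8)
    (hΓ : Γ.IsSpecial)
    (f : Multiplicative (ZMod 3 × ZMod 3) →* G) (hf : Function.Injective f) {x y : O}
    (hx : x ∈ Γ.comp (f (.ofAdd (1, 0)))) (hy : y ∈ Γ.comp (f (.ofAdd (0, 1))))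
    (hyx : y * x = 0) (α β : Fˣ) (hα : polar n x (x * x) = α) (hβ : polar n y (y * y) = β) :
    ∃ C : OkuboCoords Γ α β, C.deg = f := by
  have hmem := okuboFamily_mem f hx hy
  have hne := hΓ.okuboFamily_ne_zero hn f hf hx hy hyx α β hα hβ
  have hli : LinearIndependent F (fun a : OkuboIndex => okuboFamily x y a) := by
    refine iSupIndep.linearIndependent (fun a : OkuboIndex => Γ.comp (f (.ofAdd a))) ?_ hmem hne
    refine Γ.indep.comp (f := fun a : OkuboIndex => f (.ofAdd (a : ZMod 3 × ZMod 3))) ?_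
    exact hf.comp (Multiplicative.ofAdd.injective.comp Subtype.val_injective)
  have hcard : Fintype.card OkuboIndex = Module.finrank F O := by rw [hdim]; decide
  have : Nonempty OkuboIndex := ⟨⟨(1, 0), by decide⟩⟩
  let B := basisOfLinearIndependentOfCardEqFinrank hli hcard
  have hB : ∀ a, B a = okuboFamily x y a := fun a => by
    simp [B]
  let φ : O ≃ₗ[F] Okubo α β := B.equivFun
  have hφ : ∀ a : OkuboIndex, φ (okuboFamily x y a) = Okubo.z α β a := by
    intro a
    funext b
    rw [← hB]
    refine (B.equivFun_self a b).trans ?_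
    rw [Okubo.z_apply]
    simp only [Subtype.ext_iff, eq_comm]
  have hφ' : ∀ a : OkuboIndex, φ.symm (Okubo.z α β a) = okuboFamily x y a := fun a => by
    rw [← hφ, φ.symm_apply_apply]
  have hmul : ∀ v w, φ.symm (v * w) = φ.symm v * φ.symm w := by
    refine Okubo.map_mul_of_z (φ.symm : Okubo α β →ₗ[F] O) fun a b => ?_
    simp only [LinearEquiv.coe_coe]
    rw [hφ', hφ', hΓ.okuboFamily_mul hn f hf hx hy hyx α β hα hβ, Okubo.z_mul_z, map_smul]
    by_cases h0 : (a : ZMod 3 × ZMod 3) + b = 0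
    · have : okuboSign a b = 0 := by simp [okuboSign, h0]
      simp [Okubo.coeff, this]
    · rw [hφ' ⟨_, h0⟩]
  refine ⟨⟨φ, fun v w => ?_, f, hf, fun c => ?_⟩, rfl⟩
  · apply φ.symm.injective
    rw [hmul]
    simp
  · by_cases hc : c = 1
    · have h1 := Okubo.grading_isSpecial α β
      rw [IsSpecial] at h1 hΓ
      rw [hc, map_one, h1, hΓ, Submodule.map_bot]
    · obtain ⟨a, rfl⟩ : ∃ a : OkuboIndex, .ofAdd (a : ZMod 3 × ZMod 3) = c := ⟨⟨c.toAdd, hc⟩, rfl⟩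
      ext v
      rw [Okubo.mem_comp_iff, Submodule.mem_map]
      constructor
      · rintro ⟨u, hu, rfl⟩
        obtain ⟨k, rfl⟩ := hΓ.exists_eq_smul hn (hmem a) (hne a) hu
        exact ⟨k, by rw [map_smul]; exact congrArg _ (hφ a)⟩
      · rintro ⟨k, rfl⟩
        exact ⟨k • okuboFamily x y a, Submodule.smul_mem _ _ (hmem a), by
          rw [map_smul]; exact congrArg _ (hφ a)⟩

end AlgGrading

/-! ### Homomorphisms from `(ℤ/3)²` and cube classes. -/

section ZModHom

variable {G : Type*} [CommGroup G]

theorem pow_val_add {a : G} (ha : a ^ 3 = 1) (i j : ZMod 3) :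
    a ^ (i + j).val = a ^ i.val * a ^ j.val := by
  rw [ZMod.val_add, ← pow_eq_pow_mod _ ha, pow_add]

/-- The homomorphism from `(ℤ/3)²` determined by two elements with trivial cube. -/
def zmodThreeHom (a b : G) (ha : a ^ 3 = 1) (hb : b ^ 3 = 1) :
    Multiplicative (ZMod 3 × ZMod 3) →* G where
  toFun c := a ^ c.toAdd.1.val * b ^ c.toAdd.2.val
  map_one' := by simp
  map_mul' c d := by
    rw [toAdd_mul, Prod.fst_add, Prod.snd_add, pow_val_add ha, pow_val_add hb, mul_mul_mul_comm]

theorem zmodThreeHom_ofAdd (a b : G) (ha : a ^ 3 = 1) (hb : b ^ 3 = 1) (c : ZMod 3 × ZMod 3) :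
    zmodThreeHom a b ha hb (.ofAdd c) = a ^ c.1.val * b ^ c.2.val := rfl

theorem zmodThreeHom_one_zero (a b : G) (ha : a ^ 3 = 1) (hb : b ^ 3 = 1) :
    zmodThreeHom a b ha hb (.ofAdd (1, 0)) = a := by
  rw [zmodThreeHom_ofAdd, ZMod.val_one, ZMod.val_zero, pow_one, pow_zero, mul_one]

theorem zmodThreeHom_zero_one (a b : G) (ha : a ^ 3 = 1) (hb : b ^ 3 = 1) :
    zmodThreeHom a b ha hb (.ofAdd (0, 1)) = b := by
  rw [zmodThreeHom_ofAdd, ZMod.val_one, ZMod.val_zero, pow_one, pow_zero, one_mul]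

/-- The plane over `ℤ/3` has four lines, and each of the four hypotheses keeps one of them out of
the kernel. -/
theorem zmodThreeHom_injective {a b : G} (ha : a ^ 3 = 1) (hb : b ^ 3 = 1) (ha1 : a ≠ 1)
    (hb1 : b ≠ 1) (hab : a ≠ b) (hab1 : a * b ≠ 1) :
    Function.Injective (zmodThreeHom a b ha hb) := by
  have ha2 : a ^ 2 ≠ 1 := fun h => ha1 (by rw [pow_succ, h, one_mul] at ha; exact ha)
  have hb2 : b ^ 2 ≠ 1 := fun h => hb1 (by rw [pow_succ, h, one_mul] at hb; exact hb)
  have h1 : a * b ^ 2 ≠ 1 := fun h => hab (by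
    rw [pow_succ' b 2] at hb
    exact mul_right_cancel (h.trans hb.symm))
  have h2 : a ^ 2 * b ≠ 1 := fun h => hab (by
    rw [pow_succ a 2] at ha
    exact mul_left_cancel (ha.trans h.symm))
  have h3 : a ^ 2 * b ^ 2 ≠ 1 := fun h => hab1 (by
    have : (a * b) ^ 3 = 1 := by rw [mul_pow, ha, hb, one_mul]
    rw [← mul_pow] at h
    rwa [pow_succ, h, one_mul] at this)
  refine (injective_iff_map_eq_one _).2 fun c hc => ?_
  obtain ⟨⟨i, j⟩, rfl⟩ := Multiplicative.ofAdd.surjective c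
  rw [zmodThreeHom_ofAdd] at hc
  change a ^ i.val * b ^ j.val = 1 at hc
  have hi := ZMod.val_lt i
  have hj := ZMod.val_lt j
  have h00 : i.val = 0 ∧ j.val = 0 := by
    generalize i.val = p at *
    generalize j.val = q at *
    interval_cases p <;> interval_cases q <;> simp_all
  rw [(ZMod.val_eq_zero i).1 h00.1, (ZMod.val_eq_zero j).1 h00.2]
  rfl

end ZModHom

/-- The homomorphism `(i, j) ↦ [α]^i [β]^j` to the cube classes. -/
def cubeHom {F : Type*} [Field F] (α β : Fˣ) : Multiplicative (ZMod 3 × ZMod 3) →* CubeClasses F :=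
  zmodThreeHom (cubeClass α) (cubeClass β)
    ((QuotientGroup.eq_one_iff _).2 ⟨α, rfl⟩) ((QuotientGroup.eq_one_iff _).2 ⟨β, rfl⟩)

theorem cubeHom_ofAdd {F : Type*} [Field F] (α β : Fˣ) (c : ZMod 3 × ZMod 3) :
    cubeHom α β (.ofAdd c) = cubeClass (α ^ c.1.val * β ^ c.2.val) := rfl

theorem cubeClass_eq_iff {F : Type*} [Field F] {α β : Fˣ} :
    cubeClass α = cubeClass β ↔ ∃ t : Fˣ, β = t ^ 3 * α := by
  rw [cubeClass, cubeClass, QuotientGroup.eq]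
  constructor
  · rintro ⟨t, ht⟩
    refine ⟨t, ?_⟩
    rw [mul_comm, show t ^ 3 = α⁻¹ * β from ht, mul_inv_cancel_left]
  · rintro ⟨t, rfl⟩
    exact ⟨t, by rw [powMonoidHom_apply, mul_comm, mul_inv_cancel_right]⟩

namespace Okubo

variable {F : Type*} [Field F] {α β : Fˣ}

/-- As `4 = 1` in `ℤ/3`, the fourth power returns to degree `a`, and the carries of the three
multiplications add up to exactly `i` in the first index and `j` in the second. -/
theorem z_quartic (a : OkuboIndex) :
    (z α β a * z α β a) * (z α β a * z α β a) =
      ((α ^ a.1.1.val * β ^ a.1.2.val : Fˣ) : F) • z α β a := by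
  have h0 : ∀ a : OkuboIndex, (a : ZMod 3 × ZMod 3) + a ≠ 0 := by decide
  have h1 : ∀ a : OkuboIndex, ((a : ZMod 3 × ZMod 3) + a) + (a + a) = a ∧ okuboSign a a = 1 := by
    decide
  have h2 : ∀ i : ZMod 3, (i.val + i.val) / 3 + ((i.val + i.val) / 3 +
      ((i + i).val + (i + i).val) / 3) = i.val := by decide
  have h3 := (h1 ⟨_, h0 a⟩).2
  rw [z_mul_z, smul_mul_smul_comm]
  rw [z_mul_z ⟨_, h0 a⟩ ⟨_, h0 a⟩]
  simp only [coeff] at h3 ⊢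
  rw [smul_smul, (h1 a).1, (h1 a).2, h3]
  push_cast
  simp only [one_mul]
  congr 1
  rw [← congrArg ((α : F) ^ ·) (h2 a.1.1), ← congrArg ((β : F) ^ ·) (h2 a.1.2)]
  simp only [pow_add, Prod.fst_add, Prod.snd_add]
  ring

end Okubo

/-! ### The map `Φ` and the change of parameters. -/

namespace OkuboCoords

open AlgGrading

variable {F O G : Type*} [Field F] [NonUnitalNonAssocRing O] [Module F O] [CommGroup G]
  {Γ : AlgGrading F O G} {α β : Fˣ} (C : OkuboCoords Γ α β)
include C

/-- The components with degree in the image already span, so independence leaves nothing for other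
degrees. -/
theorem comp_eq_bot {g : G} (hg : g ∉ C.deg.range) : Γ.comp g = ⊥ := by
  have h1 : ⨆ c, Γ.comp (C.deg c) = ⊤ := by
    apply Submodule.map_injective_of_injective (f := (C.toEquiv : O →ₗ[F] Okubo α β))
      C.toEquiv.injective
    rw [Submodule.map_iSup, Submodule.map_top, LinearEquiv.range]
    simp only [C.map_comp]
    exact (Okubo.grading α β).iSup_eq_top
  have h2 : (⊤ : Submodule F O) ≤ ⨆ (k : G) (_ : k ≠ g), Γ.comp k := by
    rw [← h1]
    refine iSup_le fun c => le_iSup₂_of_le (C.deg c) ?_ le_rfl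
    rintro rfl
    exact hg ⟨c, rfl⟩
  exact disjoint_top.mp ((Γ.indep g).mono_right h2)

theorem isEquivalence : IsEquivalence Γ (Okubo.grading α β) C.toEquiv := by
  refine ⟨C.isAlgIso, fun g hg => ?_⟩
  have : g ∈ C.deg.range := by
    by_contra h
    exact hg (C.comp_eq_bot h)
  obtain ⟨c, rfl⟩ := this
  exact ⟨c, C.map_comp c⟩

theorem equivalent : Γ.Equivalent (Okubo.grading α β) := ⟨_, C.isEquivalence⟩

theorem symm_z_mem (a : OkuboIndex) :
    C.toEquiv.symm (Okubo.z α β a) ∈ Γ.comp (C.deg (.ofAdd a)) := by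
  have h := Okubo.z_mem_comp (α := α) (β := β) a
  rw [← C.map_comp] at h
  obtain ⟨u, hu, hu'⟩ := h
  rw [← hu']
  simpa using hu

theorem suppSubgroup_eq : Γ.suppSubgroup = C.deg.range := by
  refine le_antisymm ((Subgroup.closure_le _).2 fun g hg => ?_) ?_
  · by_contra h
    exact hg (C.comp_eq_bot h)
  · rintro _ ⟨c, rfl⟩
    by_cases hc : c = 1
    · rw [hc, map_one]
      exact one_mem _
    · refine Subgroup.subset_closure fun h => ?_
      have h1 := C.symm_z_mem ⟨c.toAdd, hc⟩
      change _ ∈ Γ.comp (C.deg c) at h1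
      rw [h, Submodule.mem_bot, LinearEquiv.map_eq_zero_iff] at h1
      exact Okubo.z_ne_zero _ h1

/-- The identification of `(ℤ/3)²` with the subgroup generated by the support. -/
noncomputable def degEquiv : Multiplicative (ZMod 3 × ZMod 3) ≃* Γ.suppSubgroup :=
  (C.deg.ofInjective C.deg_injective).trans (MulEquiv.subgroupCongr C.suppSubgroup_eq.symm)

/-- The homomorphism `Φ_Γ`, in coordinates. -/
noncomputable def phi : Γ.suppSubgroup →* CubeClasses F :=
  (cubeHom α β).comp (C.degEquiv.symm : Γ.suppSubgroup →* Multiplicative (ZMod 3 × ZMod 3))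

theorem phi_apply (h : Γ.suppSubgroup) : C.phi h = cubeHom α β (C.degEquiv.symm h) := rfl

variable {n : QuadraticForm F O} (hn : IsSymComp n) (hΓ : Γ.IsSpecial)
include hn hΓ

/-- The scalar is read off the fourth power, computed in `O` and in coordinates. Thus no
compatibility of the coordinates with the norm is needed. -/
theorem exists_polar_eq (a : OkuboIndex) {u : O} (hu : u ∈ Γ.comp (C.deg (.ofAdd a)))
    (hu0 : u ≠ 0) : ∃ k : Fˣ, C.toEquiv u = (k : F) • Okubo.z α β a ∧
      polar n u (u * u) = ((k ^ 3 * (α ^ a.1.1.val * β ^ a.1.2.val) : Fˣ) : F) := by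
  have h1 : C.toEquiv u ∈ (Okubo.grading α β).comp (.ofAdd a) := by
    rw [← C.map_comp]
    exact ⟨u, hu, rfl⟩
  obtain ⟨k, hk⟩ := (Okubo.mem_comp_iff _ _).1 h1
  have hk0 : k ≠ 0 := by
    rintro rfl
    rw [zero_smul] at hk
    exact hu0 ((LinearEquiv.map_eq_zero_iff _).1 hk)
  refine ⟨Units.mk0 k hk0, hk, ?_⟩
  have h2 := congrArg C.toEquiv (hΓ.quartic hn hu)
  rw [C.isAlgIso, C.isAlgIso, map_smul, hk, smul_mul_smul_comm, smul_mul_smul_comm,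
    Okubo.z_quartic, smul_smul, smul_smul] at h2
  have h3 := smul_left_injective F (Okubo.z_ne_zero a) h2
  push_cast at h3 ⊢
  rw [Units.val_mk0]
  refine mul_right_cancel₀ hk0 (h3.symm.trans ?_)
  ring

theorem isPhi : IsPhi n Γ C.phi := by
  have key : ∀ h : Γ.suppSubgroup, h ≠ 1 → ∃ a : OkuboIndex, C.degEquiv (.ofAdd a) = h := by
    intro h hh
    refine ⟨⟨(C.degEquiv.symm h).toAdd, fun h0 => hh ?_⟩, C.degEquiv.apply_symm_apply h⟩
    exact (map_eq_one_iff _ C.degEquiv.symm.injective).1 h0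
  constructor
  · intro h hh
    obtain ⟨a, rfl⟩ := key h hh
    exact ⟨_, C.symm_z_mem a, fun h => Okubo.z_ne_zero a ((LinearEquiv.map_eq_zero_iff _).1 h)⟩
  · intro h hh u hu hu0
    obtain ⟨a, rfl⟩ := key h hh
    obtain ⟨k, -, hk⟩ := C.exists_polar_eq hn hΓ a hu hu0
    refine ⟨hk ▸ Units.ne_zero _, ?_⟩
    rw [phi_apply, MulEquiv.symm_apply_apply, cubeHom_ofAdd,
      cubeClass_eq_iff]
    exact ⟨k, Units.ext hk⟩

variable [IsScalarTower F O O] [SMulCommClass F O O]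

/-- Change of the parameters `α`, `β` along an element of `SL₂(ℤ/3)`. -/
theorem nonempty_of_cubeHom (hdim : Module.finrank F O = 8) {γ δ : Fˣ} {a b : OkuboIndex}
    (hab : a.1.1 * b.1.2 - a.1.2 * b.1.1 = 1) (ha : cubeHom α β (.ofAdd a) = cubeClass γ)
    (hb : cubeHom α β (.ofAdd b) = cubeClass δ) : Nonempty (OkuboCoords Γ γ δ) := by
  -- Equality of cube classes allows rescaling a basis vector by some `t` so that its cubic value
  -- becomes exactly `γ`.
  have key : ∀ (a : OkuboIndex) (γ : Fˣ), cubeHom α β (.ofAdd a) = cubeClass γ →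
      ∃ (t : Fˣ) (x : O), x ∈ Γ.comp (C.deg (.ofAdd a)) ∧ C.toEquiv x = (t : F) • Okubo.z α β a ∧
        polar n x (x * x) = γ := by
    intro a γ ha
    rw [cubeHom_ofAdd, cubeClass_eq_iff] at ha
    obtain ⟨t, ht⟩ := ha
    have hm := Submodule.smul_mem _ (t : F) (C.symm_z_mem a)
    have hφ : C.toEquiv ((t : F) • C.toEquiv.symm (Okubo.z α β a)) = (t : F) • Okubo.z α β a := by
      rw [map_smul, LinearEquiv.apply_symm_apply]
    refine ⟨t, _, hm, hφ, ?_⟩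
    have h0 : (t : F) • C.toEquiv.symm (Okubo.z α β a) ≠ 0 := by
      intro h
      rw [h, map_zero] at hφ
      exact smul_ne_zero t.ne_zero (Okubo.z_ne_zero a) hφ.symm
    obtain ⟨k, hk, hk'⟩ := C.exists_polar_eq hn hΓ a hm h0
    have hkt : k = t := Units.ext (smul_left_injective F (Okubo.z_ne_zero a) (hk.symm.trans hφ))
    rw [hk', hkt, ht]
  obtain ⟨s, x, hx, hxs, hxγ⟩ := key a γ ha
  obtain ⟨t, y, hy, hyt, hyδ⟩ := key b δ hb
  have hyx : y * x = 0 := by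
    apply C.toEquiv.injective
    -- Determinant `1` for `(a, b)` means `2` for `(b, a)`; this orientation gives the normalization
    -- `y*x = 0`.
    have : okuboSign b a = 0 := by
      revert hab; clear * -; revert a b; decide
    rw [C.isAlgIso, hxs, hyt, smul_mul_smul_comm, Okubo.z_mul_z, Okubo.coeff, this, map_zero]
    simp
  have hcube : ∀ c : OkuboIndex, C.deg (.ofAdd c) ^ 3 = 1 := by
    intro c
    rw [← map_pow, ← ofAdd_nsmul, map_eq_one_iff _ C.deg_injective]
    revert c; decide
  have hne : a ≠ b ∧ (a : ZMod 3 × ZMod 3) + b ≠ 0 := by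
    revert hab; clear * -; revert a b; decide
  have hinj := zmodThreeHom_injective (hcube a) (hcube b)
    (fun h => a.2 ((map_eq_one_iff _ C.deg_injective).1 h))
    (fun h => b.2 ((map_eq_one_iff _ C.deg_injective).1 h))
    (fun h => hne.1 (Subtype.ext (C.deg_injective h)))
    (fun h => hne.2 (by
      rw [← map_mul, ← ofAdd_add] at h
      exact (map_eq_one_iff _ C.deg_injective).1 h))
  obtain ⟨C', -⟩ := hΓ.nonempty_okuboCoords hn hdim _ hinj (x := x) (y := y)
    (by rwa [zmodThreeHom_one_zero]) (by rwa [zmodThreeHom_zero_one]) hyx γ δ hxγ hyδ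
  exact ⟨C'⟩

end OkuboCoords

namespace AlgGrading

variable {F O G : Type*} [Field F] [NonUnitalNonAssocRing O] [Module F O]
  [IsScalarTower F O O] [SMulCommClass F O O] [CommGroup G] {Γ : AlgGrading F O G}
  {n : QuadraticForm F O}

/-- If every homogeneous element had degree `a` or `a⁻¹ = a*a`, then `O` would be spanned by `x` and
`x*x`, against dimension 8. So two independent degrees occur, and whichever order gives a nonzero
product serves as the pair of generators. -/
theorem IsSpecial.exists_okuboCoords (hn : IsSymComp n) (hdim : Module.finrank F O = 8)
    (hΓ : Γ.IsSpecial) : ∃ α β : Fˣ, Nonempty (OkuboCoords Γ α β) := by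
  have hfin : FiniteDimensional F O := FiniteDimensional.of_finrank_pos (by omega)
  have hnt : Nontrivial O := Module.nontrivial_of_finrank_pos (R := F) (by omega)
  have hne_one : ∀ {g : G} {x : O}, x ∈ Γ.comp g → x ≠ 0 → g ≠ 1 := by
    rintro g x hx hx0 rfl
    rw [IsSpecial] at hΓ
    rw [hΓ] at hx
    exact hx0 ((Submodule.mem_bot F).1 hx)
  have hcube : ∀ {g : G} {x : O}, x ∈ Γ.comp g → x ≠ 0 → g ^ 3 = 1 := fun hx hx0 => by
    rw [pow_succ', pow_two]
    exact hΓ.mul_mul_eq_one hn hx hx0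
  have key : ∀ {a b : G} {x y : O}, x ∈ Γ.comp a → y ∈ Γ.comp b → a ≠ b → a * b ≠ 1 →
      x * y ≠ 0 → ∃ α β : Fˣ, Nonempty (OkuboCoords Γ α β) := by
    intro a b x y hx hy hab hab1 hxy
    have hx0 : x ≠ 0 := fun h => hxy (by rw [h, zero_mul])
    have hy0 : y ≠ 0 := fun h => hxy (by rw [h, mul_zero])
    have hinj := zmodThreeHom_injective (hcube hx hx0) (hcube hy hy0) (hne_one hx hx0)
      (hne_one hy hy0) hab hab1
    obtain ⟨C, -⟩ := hΓ.nonempty_okuboCoords hn hdim _ hinj (x := x) (y := y)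
      (by rwa [zmodThreeHom_one_zero]) (by rwa [zmodThreeHom_zero_one])
      (hΓ.mul_eq_zero_of_mul_ne_zero hn hab1 hab hx hy hxy)
      (Units.mk0 _ (hΓ.cubic_ne_zero hn hx hx0)) (Units.mk0 _ (hΓ.cubic_ne_zero hn hy hy0)) rfl rfl
    exact ⟨_, _, ⟨C⟩⟩
  obtain ⟨a, x, hx, hx0⟩ := Γ.exists_mem_of_forall
  have hxx := hΓ.mul_self_ne_zero hn hx hx0
  have : ∃ b, ∃ y ∈ Γ.comp b, y ≠ 0 ∧ a ≠ b ∧ a * b ≠ 1 := by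
    by_contra! h
    classical
    have htop : (⊤ : Submodule F O) ≤ Submodule.span F (({x, x * x} : Finset O) : Set O) := by
      rw [← Γ.iSup_eq_top]
      refine iSup_le fun b y hy => ?_
      by_cases hy0 : y = 0
      · rw [hy0]
        exact zero_mem _
      by_cases hab : a = b
      · subst hab
        obtain ⟨c, rfl⟩ := hΓ.exists_eq_smul hn hx hx0 hy
        exact Submodule.smul_mem _ _ (Submodule.subset_span (by simp))
      · have hb : b = a * a := by
          have h1 := h b y hy hy0 hab
          exact mul_left_cancel (h1.trans (hΓ.mul_mul_eq_one hn hx hx0).symm)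
        subst hb
        obtain ⟨c, rfl⟩ := hΓ.exists_eq_smul hn (Γ.mul_mem hx hx) hxx hy
        exact Submodule.smul_mem _ _ (Submodule.subset_span (by simp))
    have h1 := finrank_span_finset_le_card (R := F) ({x, x * x} : Finset O)
    have h2 := Finset.card_le_two (a := x) (b := x * x)
    rw [Set.finrank, top_le_iff.1 htop, finrank_top, hdim] at h1
    omega
  obtain ⟨b, y, hy, hy0, hab, hab1⟩ := this
  rcases hΓ.mul_ne_zero_or hn hab1 hx hy hx0 hy0 with h | h
  · exact key hx hy hab hab1 h
  · exact key hy hx hab.symm (by rwa [mul_comm]) h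

end AlgGrading

/-! ### Transfer of automorphism groups along equivalences. -/

namespace AlgGrading

section Transfer

variable {F A B C G H I : Type*} [Field F] [NonUnitalNonAssocRing A] [Module F A]
  [NonUnitalNonAssocRing B] [Module F B] [NonUnitalNonAssocRing C] [Module F C]
  [CommGroup G] [CommGroup H] [CommGroup I]
  {Γ : AlgGrading F A G} {Γ' : AlgGrading F B H} {Γ'' : AlgGrading F C I}

theorem IsEquivalence.symm {φ : A ≃ₗ[F] B} (hφ : IsEquivalence Γ Γ' φ) :
    IsEquivalence Γ' Γ φ.symm := by
  refine ⟨fun x y => ?_, fun h hh => ?_⟩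
  · apply φ.injective
    rw [hφ.1]
    simp
  · obtain ⟨g, hg⟩ := hφ.exists_map_eq hh
    refine ⟨g, ?_⟩
    rw [← hg, ← Submodule.map_comp]
    convert Submodule.map_id _
    ext x
    exact φ.symm_apply_apply x

theorem IsEquivalence.trans {φ : A ≃ₗ[F] B} {ψ : B ≃ₗ[F] C} (hφ : IsEquivalence Γ Γ' φ)
    (hψ : IsEquivalence Γ' Γ'' ψ) : IsEquivalence Γ Γ'' (φ.trans ψ) := by
  refine ⟨fun x y => ?_, fun g hg => ?_⟩
  · rw [LinearEquiv.trans_apply, hφ.1, hψ.1]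
    rfl
  · obtain ⟨h, hh⟩ := hφ.2 g hg
    have hs : h ∈ Γ'.supp := by
      intro h0
      rw [h0] at hh
      exact hg ((Submodule.map_eq_bot_iff (e := φ)).mp hh)
    obtain ⟨k, hk⟩ := hψ.2 h hs
    refine ⟨k, ?_⟩
    rw [← hk, ← hh, ← Submodule.map_comp]
    rfl

theorem Equivalent.symm (h : Γ.Equivalent Γ') : Γ'.Equivalent Γ :=
  h.imp' _ fun _ hφ => hφ.symm

theorem Equivalent.trans (h : Γ.Equivalent Γ') (h' : Γ'.Equivalent Γ'') : Γ.Equivalent Γ'' := by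
  obtain ⟨φ, hφ⟩ := h
  obtain ⟨ψ, hψ⟩ := h'
  exact ⟨_, hφ.trans hψ⟩

/-- An equivalence identifies the automorphism groups of the gradings. -/
def IsEquivalence.autCongr {φ : A ≃ₗ[F] B} (hφ : IsEquivalence Γ Γ' φ) :
    Γ.autGroup ≃* Γ'.autGroup where
  toFun ψ := ⟨(φ.symm.trans (ψ : A ≃ₗ[F] A)).trans φ, (hφ.symm.trans ψ.2).trans hφ⟩
  invFun ψ := ⟨(φ.trans (ψ : B ≃ₗ[F] B)).trans φ.symm, (hφ.trans ψ.2).trans hφ.symm⟩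
  left_inv ψ := by
    ext x
    simp
  right_inv ψ := by
    ext x
    simp
  map_mul' ψ χ := by
    ext x
    simp [LinearEquiv.mul_apply]

theorem IsEquivalence.autCongr_mem {φ : A ≃ₗ[F] B} (hφ : IsEquivalence Γ Γ' φ) {ψ : Γ.autGroup}
    (hψ : ψ ∈ Γ.stabGroup) : hφ.autCongr ψ ∈ Γ'.stabGroup := by
  intro h
  by_cases hh : h ∈ Γ'.supp
  · obtain ⟨g, hg⟩ := hφ.exists_map_eq hh
    have h1 := hψ g
    rw [← hg]
    nth_rewrite 2 [← h1]
    rw [← Submodule.map_comp, ← Submodule.map_comp]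
    congr 1
    ext x
    simp [autCongr]
  · have : Γ'.comp h = ⊥ := by
      by_contra h0
      exact hh h0
    simp [this]

theorem IsEquivalence.map_stabGroup {φ : A ≃ₗ[F] B} (hφ : IsEquivalence Γ Γ' φ) :
    Γ.stabGroup.map (hφ.autCongr : Γ.autGroup →* Γ'.autGroup) = Γ'.stabGroup := by
  refine le_antisymm ?_ fun ψ hψ => ⟨hφ.autCongr.symm ψ, ?_, hφ.autCongr.apply_symm_apply ψ⟩
  · rintro _ ⟨ψ, hψ, rfl⟩
    exact hφ.autCongr_mem hψ
  · exact hφ.symm.autCongr_mem hψ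

theorem Equivalent.nonempty_stabGroup (h : Γ.Equivalent Γ') :
    Nonempty (Γ.stabGroup ≃* Γ'.stabGroup) := by
  obtain ⟨φ, hφ⟩ := h
  exact ⟨(hφ.autCongr.subgroupMap Γ.stabGroup).trans (MulEquiv.subgroupCongr hφ.map_stabGroup)⟩

/-- If a group `K` acts by equivalences so that it represents each class of the Weyl group exactly
once, then the Weyl group is isomorphic to `K` and the sequence splits. -/
theorem Equivalent.weylGroup {K : Type*} [Group K] (h : Γ.Equivalent Γ') (f : K →* Γ'.autGroup)
    (hinj : ∀ k, f k ∈ Γ'.stabGroup → k = 1)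
    (hsurj : ∀ ψ : Γ'.autGroup, ∃ k, (f k)⁻¹ * ψ ∈ Γ'.stabGroup) :
    Γ.WeylSequenceSplits ∧ Nonempty (Γ.weylGroup ≃* K) := by
  obtain ⟨φ, hφ⟩ := h
  let f' : K →* Γ.autGroup := (hφ.autCongr.symm : Γ'.autGroup →* Γ.autGroup).comp f
  have hf' : ∀ ψ, hφ.autCongr.symm ψ ∈ Γ.stabGroup ↔ ψ ∈ Γ'.stabGroup := by
    refine fun ψ => ⟨fun h => ?_, fun h => hφ.symm.autCongr_mem h⟩
    have := hφ.autCongr_mem h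
    rwa [MulEquiv.apply_symm_apply] at this
  have hbij : Function.Bijective ((QuotientGroup.mk' Γ.stabGroup).comp f') := by
    refine ⟨(injective_iff_map_eq_one _).2 fun k hk => hinj k ?_, fun w => ?_⟩
    · exact (hf' _).1 ((QuotientGroup.eq_one_iff _).1 hk)
    · obtain ⟨ψ, rfl⟩ := QuotientGroup.mk'_surjective _ w
      obtain ⟨k, hk⟩ := hsurj (hφ.autCongr ψ)
      refine ⟨k, QuotientGroup.eq.2 ?_⟩
      rw [← hf', map_mul, map_inv, MulEquiv.symm_apply_apply] at hk
      exact hk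
  let e := MulEquiv.ofBijective _ hbij
  refine ⟨⟨f'.comp (e.symm : Γ.weylGroup →* K), ?_⟩, ⟨e.symm⟩⟩
  ext w
  exact e.apply_symm_apply _

end Transfer

end AlgGrading

/-! ### Equivalences between the algebras `𝒪_{α,β}`. -/

namespace Okubo

open AlgGrading

variable {F : Type*} [Field F] {α β γ δ : Fˣ}

theorem coeff_eq_zero_iff (a b : ZMod 3 × ZMod 3) : coeff α β a b = 0 ↔ okuboSign a b = 0 := by
  have h : okuboSign a b = 0 ∨ okuboSign a b = 1 ∨ okuboSign a b = -1 := by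
    revert a b; decide
  rcases h with h | h | h <;> simp [coeff, h]

/-- The basis vectors `z̃_{1,0}` and `z̃_{0,1}` generate `𝒪_{α,β}`. -/
theorem index_induction {p : ZMod 3 × ZMod 3 → Prop} (h₁ : p (1, 0)) (h₂ : p (0, 1))
    (h : ∀ a b : OkuboIndex, okuboSign a b ≠ 0 → p a → p b → p ((a : ZMod 3 × ZMod 3) + b))
    (a : OkuboIndex) : p a := by
  have h20 : p (2, 0) := h ⟨(1, 0), by decide⟩ ⟨(1, 0), by decide⟩ (by decide) h₁ h₁
  have h02 : p (0, 2) := h ⟨(0, 1), by decide⟩ ⟨(0, 1), by decide⟩ (by decide) h₂ h₂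
  have h11 : p (1, 1) := h ⟨(1, 0), by decide⟩ ⟨(0, 1), by decide⟩ (by decide) h₁ h₂
  have h22 : p (2, 2) := h ⟨(1, 1), by decide⟩ ⟨(1, 1), by decide⟩ (by decide) h11 h11
  have h12 : p (1, 2) := h ⟨(1, 1), by decide⟩ ⟨(0, 1), by decide⟩ (by decide) h11 h₂
  have h21 : p (2, 1) := h ⟨(1, 2), by decide⟩ ⟨(1, 2), by decide⟩ (by decide) h12 h12
  revert a
  exact forall_index.2 ⟨h₂, h02, h₁, h11, h12, h20, h21, h22⟩

theorem z_add {a b : OkuboIndex} (h : okuboSign a b ≠ 0) :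
    z α β ((a : ZMod 3 × ZMod 3) + b) = (coeff α β a b)⁻¹ • (z α β a * z α β b) := by
  rw [z_mul_z, inv_smul_smul₀ (mt (coeff_eq_zero_iff _ _).1 h)]

theorem linearEquiv_ext {A : Type*} [AddCommGroup A] [Module F A] {T T' : Okubo α β ≃ₗ[F] A}
    (h : ∀ a : OkuboIndex, T (z α β a) = T' (z α β a)) : T = T' := by
  ext x
  rw [eq_sum x]
  simp only [map_sum, map_smul, h]

theorem isAlgIso_ext {A : Type*} [NonUnitalNonAssocRing A] [Module F A] {T T' : Okubo α β ≃ₗ[F] A}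
    (hT : IsAlgIso T) (hT' : IsAlgIso T') (h₁ : T (z α β (1, 0)) = T' (z α β (1, 0)))
    (h₂ : T (z α β (0, 1)) = T' (z α β (0, 1))) : T = T' := by
  refine linearEquiv_ext (index_induction (p := fun a => T (z α β a) = T' (z α β a)) h₁ h₂ ?_)
  intro a b hab ha hb
  rw [z_add hab, map_smul, map_smul, hT, hT', ha, hb]

/-- The image lies in a nontrivial component, hence on a basis line. Comparing fourth powers shows
that the two cubic values differ by `k³`, so equivalences respect `Φ`. -/
theorem exists_map_z {φ : Okubo α β ≃ₗ[F] Okubo γ δ}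
    (hφ : IsEquivalence (grading α β) (grading γ δ) φ) (a : OkuboIndex) :
    ∃ (b : OkuboIndex) (k : Fˣ), φ (z α β a) = (k : F) • z γ δ b ∧
      cubeHom α β (.ofAdd a) = cubeHom γ δ (.ofAdd b) := by
  have hne : φ (z α β a) ≠ 0 := fun h => z_ne_zero a ((LinearEquiv.map_eq_zero_iff _).1 h)
  obtain ⟨h, hh⟩ := hφ.2 (.ofAdd a) fun h0 => z_ne_zero a
    ((Submodule.mem_bot F).1 (h0 ▸ z_mem_comp (α := α) (β := β) a))
  have hm : φ (z α β a) ∈ (grading γ δ).comp h := by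
    rw [← hh]
    exact ⟨_, z_mem_comp a, rfl⟩
  have h1 : h ≠ 1 := by
    rintro rfl
    have := grading_isSpecial γ δ
    rw [IsSpecial] at this
    rw [this] at hm
    exact hne ((Submodule.mem_bot F).1 hm)
  obtain ⟨b, rfl⟩ : ∃ b : OkuboIndex, .ofAdd (b : ZMod 3 × ZMod 3) = h := ⟨⟨h.toAdd, h1⟩, rfl⟩
  obtain ⟨k, hk⟩ := (mem_comp_iff _ _).1 hm
  have hk0 : k ≠ 0 := by
    rintro rfl
    rw [zero_smul] at hk
    exact hne hk
  refine ⟨b, Units.mk0 k hk0, hk, ?_⟩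
  have h2 := congrArg φ (z_quartic (α := α) (β := β) a)
  rw [hφ.1, hφ.1, map_smul, hk, smul_mul_smul_comm, smul_mul_smul_comm, z_quartic, smul_smul,
    smul_smul] at h2
  have h3 := smul_left_injective F (z_ne_zero b) h2
  rw [cubeHom_ofAdd, cubeHom_ofAdd, eq_comm, cubeClass_eq_iff]
  refine ⟨Units.mk0 k hk0, Units.ext ?_⟩
  refine mul_right_cancel₀ hk0 (h3.symm.trans ?_)
  push_cast
  rw [Units.val_mk0]
  ring

/-- Of the two products of the generators exactly one is nonzero, and the isomorphism preserves
which one. Among index pairs only determinant one shows this pattern, so determinant `-1` is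
excluded. -/
theorem det_eq_one {φ : Okubo α β ≃ₗ[F] Okubo γ δ} (hφ : IsAlgIso φ) {c d : OkuboIndex}
    {k l : Fˣ} (hc : φ (z α β (1, 0)) = (k : F) • z γ δ c)
    (hd : φ (z α β (0, 1)) = (l : F) • z γ δ d) : c.1.1 * d.1.2 - c.1.2 * d.1.1 = 1 := by
  have h1 : okuboSign c d ≠ 0 := by
    intro h
    have h2 := hφ (z α β (1, 0)) (z α β (0, 1))
    rw [hc, hd, smul_mul_smul_comm, z_mul_z, (coeff_eq_zero_iff _ _).2 h, zero_smul, smul_zero,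
      LinearEquiv.map_eq_zero_iff, z_mul_z ⟨(1, 0), by decide⟩ ⟨(0, 1), by decide⟩] at h2
    refine smul_ne_zero ?_ (z_ne_zero ⟨(1, 0) + (0, 1), by decide⟩) h2
    rw [Ne, coeff_eq_zero_iff]
    decide
  have h2 : okuboSign d c = 0 := by
    by_cases h0 : (d : ZMod 3 × ZMod 3) + c = 0
    · simp [okuboSign, h0]
    have h2 := hφ (z α β (0, 1)) (z α β (1, 0))
    rw [hc, hd, smul_mul_smul_comm, z_mul_z, z_mul_z ⟨(0, 1), by decide⟩ ⟨(1, 0), by decide⟩,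
      (coeff_eq_zero_iff _ _).2 (by decide), zero_smul, map_zero, smul_smul] at h2
    have h3 := (smul_eq_zero.1 h2.symm).resolve_right (z_ne_zero ⟨_, h0⟩)
    exact (coeff_eq_zero_iff _ _).1 ((mul_eq_zero.1 h3).resolve_left
      (mul_ne_zero l.ne_zero k.ne_zero))
  have key : ∀ c d : OkuboIndex, okuboSign c d ≠ 0 → okuboSign d c = 0 →
      c.1.1 * d.1.2 - c.1.2 * d.1.1 = 1 := by decide
  exact key c d h1 h2

theorem mem_stabGroup {ψ : (grading α β).autGroup} {k l : F}
    (h₁ : (ψ : Okubo α β ≃ₗ[F] Okubo α β) (z α β (1, 0)) = k • z α β (1, 0))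
    (h₂ : (ψ : Okubo α β ≃ₗ[F] Okubo α β) (z α β (0, 1)) = l • z α β (0, 1)) :
    ψ ∈ (grading α β).stabGroup := by
  have key := index_induction
    (p := fun a => ∃ k : F, (ψ : Okubo α β ≃ₗ[F] Okubo α β) (z α β a) = k • z α β a)
    ⟨k, h₁⟩ ⟨l, h₂⟩ (by
      rintro a b hab ⟨r, hr⟩ ⟨s, hs⟩
      refine ⟨r * s, ?_⟩
      rw [z_add hab, map_smul, ψ.2.1, hr, hs, smul_mul_smul_comm, smul_comm])
  intro g
  by_cases hg : g = 1
  · have h1 := grading_isSpecial α β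
    rw [IsSpecial] at h1
    rw [hg, h1, Submodule.map_bot]
  obtain ⟨a, rfl⟩ : ∃ a : OkuboIndex, .ofAdd (a : ZMod 3 × ZMod 3) = g := ⟨⟨g.toAdd, hg⟩, rfl⟩
  obtain ⟨k, hk⟩ := key a
  have hk0 : k ≠ 0 := by
    rintro rfl
    rw [zero_smul, LinearEquiv.map_eq_zero_iff] at hk
    exact z_ne_zero a hk
  ext v
  rw [mem_comp_iff, Submodule.mem_map]
  constructor
  · rintro ⟨u, hu, rfl⟩
    obtain ⟨c, rfl⟩ := (mem_comp_iff _ _).1 hu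
    exact ⟨c * k, by rw [map_smul, LinearEquiv.coe_coe, hk, smul_smul]⟩
  · rintro ⟨c, rfl⟩
    refine ⟨(c * k⁻¹) • z α β a, Submodule.smul_mem _ _ (z_mem_comp a), ?_⟩
    rw [map_smul, LinearEquiv.coe_coe, hk, smul_smul, inv_mul_cancel_right₀ hk0]

theorem exists_eq_smul_of_mem_stabGroup {ψ : (grading α β).autGroup}
    (hψ : ψ ∈ (grading α β).stabGroup) (a : OkuboIndex) :
    ∃ k : F, (ψ : Okubo α β ≃ₗ[F] Okubo α β) (z α β a) = k • z α β a := by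
  rw [← mem_comp_iff, ← hψ]
  exact ⟨_, z_mem_comp a, rfl⟩

end Okubo

/-! ### Diagonal automorphisms and the permutations by `SL₂(ℤ/3)`. -/

namespace Okubo

open AlgGrading

variable {F : Type*} [Field F] {α β : Fˣ}

/-- The diagonal automorphism attached to a character of `(ℤ/3)²`. -/
def diag (α β : Fˣ) (χ : Multiplicative (ZMod 3 × ZMod 3) →* Fˣ) : Okubo α β ≃ₗ[F] Okubo α β where
  toFun x := fun a => (χ (.ofAdd a) : F) * x a
  invFun x := fun a => ((χ (.ofAdd a))⁻¹ : Fˣ) * x a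
  map_add' x y := by
    funext a
    exact mul_add _ _ _
  map_smul' r x := by
    funext a
    exact mul_left_comm _ _ _
  left_inv x := by
    funext a
    exact Units.inv_mul_cancel_left _ _
  right_inv x := by
    funext a
    exact Units.mul_inv_cancel_left _ _

theorem diag_apply (χ : Multiplicative (ZMod 3 × ZMod 3) →* Fˣ) (x : Okubo α β) (a : OkuboIndex) :
    diag α β χ x a = (χ (.ofAdd a) : F) * x a := rfl

theorem diag_z (χ : Multiplicative (ZMod 3 × ZMod 3) →* Fˣ) (a : ZMod 3 × ZMod 3) :
    diag α β χ (z α β a) = (χ (.ofAdd a) : F) • z α β a := by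
  funext b
  rw [diag_apply, smul_apply, z_apply]
  split_ifs with h
  · rw [h]
  · rw [mul_zero, mul_zero]

theorem isAlgIso_diag (χ : Multiplicative (ZMod 3 × ZMod 3) →* Fˣ) : IsAlgIso (diag α β χ) := by
  intro x y
  funext c
  simp only [diag_apply, mul_apply, Finset.mul_sum]
  refine Finset.sum_congr rfl fun a _ => Finset.sum_congr rfl fun b _ => ?_
  split_ifs with h
  · rw [← h, ofAdd_add, map_mul]
    push_cast
    ring
  · rw [mul_zero]

theorem map_diag (χ : Multiplicative (ZMod 3 × ZMod 3) →* Fˣ)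
    (g : Multiplicative (ZMod 3 × ZMod 3)) :
    ((grading α β).comp g).map (diag α β χ : Okubo α β →ₗ[F] Okubo α β) =
      (grading α β).comp g := by
  ext v
  rw [Submodule.mem_map]
  constructor
  · rintro ⟨u, hu, rfl⟩ a ha
    rw [LinearEquiv.coe_coe, diag_apply, hu a ha, mul_zero]
  · intro hv
    refine ⟨(diag α β χ).symm v, fun a ha => ?_, (diag α β χ).apply_symm_apply v⟩
    change ((χ (.ofAdd a))⁻¹ : Fˣ) * v a = 0
    rw [hv a ha, mul_zero]

/-- The diagonal automorphisms stabilize the grading. -/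
def diagStab (α β : Fˣ) (χ : Multiplicative (ZMod 3 × ZMod 3) →* Fˣ) : (grading α β).stabGroup :=
  ⟨⟨diag α β χ, isAlgIso_diag χ, fun g _ => ⟨g, map_diag χ g⟩⟩, map_diag χ⟩

theorem coe_diagStab (χ : Multiplicative (ZMod 3 × ZMod 3) →* Fˣ) :
    ((diagStab α β χ : (grading α β).autGroup) : Okubo α β ≃ₗ[F] Okubo α β) = diag α β χ := rfl

/-- The character of `(ℤ/3)²` attached to two cubic roots of unity. -/
def rootsChar (p : rootsOfUnity 3 F × rootsOfUnity 3 F) :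
    Multiplicative (ZMod 3 × ZMod 3) →* Fˣ :=
  zmodThreeHom (p.1 : Fˣ) p.2 ((mem_rootsOfUnity _ _).1 p.1.2) ((mem_rootsOfUnity _ _).1 p.2.2)

theorem rootsChar_ofAdd (p : rootsOfUnity 3 F × rootsOfUnity 3 F) (a : ZMod 3 × ZMod 3) :
    rootsChar p (.ofAdd a) = (p.1 : Fˣ) ^ a.1.val * (p.2 : Fˣ) ^ a.2.val := rfl

/-- The diagonal automorphism with prescribed eigenvalues on `z̃_{1,0}` and `z̃_{0,1}`. -/
def diagHom (α β : Fˣ) : rootsOfUnity 3 F × rootsOfUnity 3 F →* (grading α β).stabGroup where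
  toFun p := diagStab α β (rootsChar p)
  map_one' := by
    refine Subtype.ext (Subtype.ext (linearEquiv_ext fun a => ?_))
    rw [coe_diagStab, diag_z, rootsChar_ofAdd]
    simp
  map_mul' p q := by
    refine Subtype.ext (Subtype.ext (linearEquiv_ext fun a => ?_))
    rw [Subgroup.coe_mul, Subgroup.coe_mul, LinearEquiv.mul_apply]
    simp only [coe_diagStab, diag_z, map_smul, smul_smul, rootsChar_ofAdd, Prod.fst_mul,
      Prod.snd_mul, Subgroup.coe_mul, mul_pow, Units.val_mul]
    congr 1
    ring

theorem diagHom_apply_z (p : rootsOfUnity 3 F × rootsOfUnity 3 F) (a : ZMod 3 × ZMod 3) :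
    ((diagHom α β p : (grading α β).autGroup) : Okubo α β ≃ₗ[F] Okubo α β) (z α β a) =
      (((p.1 : Fˣ) ^ a.1.val * (p.2 : Fˣ) ^ a.2.val : Fˣ) : F) • z α β a :=
  diag_z _ a

/-- An eigenvalue `k` on a basis vector satisfies `k⁴ = k` by the fourth power identity, so it is a
cubic root of unity. The two eigenvalues on the generators are arbitrary and determine the
automorphism. -/
theorem diagHom_bijective (α β : Fˣ) : Function.Bijective (diagHom α β) := by
  have h10 : ∀ p : rootsOfUnity 3 F × rootsOfUnity 3 F,
      ((diagHom α β p : (grading α β).autGroup) : Okubo α β ≃ₗ[F] Okubo α β) (z α β (1, 0)) =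
        ((p.1 : Fˣ) : F) • z α β (1, 0) := by
    intro p
    rw [diagHom_apply_z, ZMod.val_one, ZMod.val_zero, pow_one, pow_zero, mul_one]
  have h01 : ∀ p : rootsOfUnity 3 F × rootsOfUnity 3 F,
      ((diagHom α β p : (grading α β).autGroup) : Okubo α β ≃ₗ[F] Okubo α β) (z α β (0, 1)) =
        ((p.2 : Fˣ) : F) • z α β (0, 1) := by
    intro p
    rw [diagHom_apply_z, ZMod.val_one, ZMod.val_zero, pow_one, pow_zero, one_mul]
  have hz10 := z_ne_zero (α := α) (β := β) ⟨(1, 0), by decide⟩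
  have hz01 := z_ne_zero (α := α) (β := β) ⟨(0, 1), by decide⟩
  constructor
  · intro p q hpq
    refine Prod.ext (Subtype.ext (Units.ext ?_)) (Subtype.ext (Units.ext ?_))
    · refine smul_left_injective F hz10 ?_
      change ((p.1 : Fˣ) : F) • z α β (1, 0) = ((q.1 : Fˣ) : F) • z α β (1, 0)
      rw [← h10, ← h10, hpq]
    · refine smul_left_injective F hz01 ?_
      change ((p.2 : Fˣ) : F) • z α β (0, 1) = ((q.2 : Fˣ) : F) • z α β (0, 1)
      rw [← h01, ← h01, hpq]
  · rintro ⟨ψ, hψ⟩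
    have key : ∀ a : OkuboIndex, ∃ k : rootsOfUnity 3 F,
        (ψ : Okubo α β ≃ₗ[F] Okubo α β) (z α β a) = ((k : Fˣ) : F) • z α β a := by
      intro a
      obtain ⟨k, hk⟩ := exists_eq_smul_of_mem_stabGroup hψ a
      have hk0 : k ≠ 0 := by
        rintro rfl
        rw [zero_smul, LinearEquiv.map_eq_zero_iff] at hk
        exact z_ne_zero a hk
      refine ⟨⟨Units.mk0 k hk0, Units.ext ?_⟩, hk⟩
      have h2 := congrArg (ψ : Okubo α β ≃ₗ[F] Okubo α β) (z_quartic (α := α) (β := β) a)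
      rw [ψ.2.1, ψ.2.1, map_smul, hk, smul_mul_smul_comm, smul_mul_smul_comm, z_quartic, smul_smul,
        smul_smul] at h2
      have h3 := smul_left_injective F (z_ne_zero a) h2
      push_cast
      rw [Units.val_mk0]
      refine mul_right_cancel₀ (mul_ne_zero hk0
        (α ^ a.1.1.val * β ^ a.1.2.val : Fˣ).ne_zero) (Eq.trans ?_ (h3.trans ?_))
      · ring
      · ring
    obtain ⟨k, hk⟩ := key ⟨(1, 0), by decide⟩
    obtain ⟨l, hl⟩ := key ⟨(0, 1), by decide⟩
    refine ⟨(k, l), Subtype.ext (Subtype.ext (isAlgIso_ext ?_ ψ.2.1 ?_ ?_))⟩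
    · exact (diagHom α β (k, l)).1.2.1
    · rw [h10]
      exact hk.symm
    · rw [h01]
      exact hl.symm

/-- The stabilizer of `Γ_{α,β}` is `μ₃(F)²`. -/
theorem nonempty_stabGroup (α β : Fˣ) :
    Nonempty ((grading α β).stabGroup ≃* rootsOfUnity 3 F × rootsOfUnity 3 F) :=
  ⟨(MulEquiv.ofBijective _ (diagHom_bijective α β)).symm⟩

/-- The action of `SL₂(ℤ/3)` on `(ℤ/3)²`. -/
def slAct (A : Matrix.SpecialLinearGroup (Fin 2) (ZMod 3)) (p : ZMod 3 × ZMod 3) :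
    ZMod 3 × ZMod 3 :=
  (A 0 0 * p.1 + A 0 1 * p.2, A 1 0 * p.1 + A 1 1 * p.2)

theorem slAct_one (p : ZMod 3 × ZMod 3) : slAct 1 p = p := by
  simp [slAct]

theorem slAct_mul (A B : Matrix.SpecialLinearGroup (Fin 2) (ZMod 3)) (p : ZMod 3 × ZMod 3) :
    slAct (A * B) p = slAct A (slAct B p) := by
  simp only [slAct, Matrix.SpecialLinearGroup.coe_mul, Matrix.mul_apply, Fin.sum_univ_two]
  refine Prod.ext ?_ ?_ <;> simp only <;> ring

theorem slAct_add (A : Matrix.SpecialLinearGroup (Fin 2) (ZMod 3)) (p q : ZMod 3 × ZMod 3) :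
    slAct A (p + q) = slAct A p + slAct A q := by
  refine Prod.ext ?_ ?_ <;> simp only [slAct, Prod.fst_add, Prod.snd_add] <;> ring

theorem slAct_zero (A : Matrix.SpecialLinearGroup (Fin 2) (ZMod 3)) : slAct A 0 = 0 := by
  simp [slAct]

theorem slAct_inv_slAct (A : Matrix.SpecialLinearGroup (Fin 2) (ZMod 3)) (p : ZMod 3 × ZMod 3) :
    slAct A⁻¹ (slAct A p) = p := by
  rw [← slAct_mul, inv_mul_cancel, slAct_one]

theorem slAct_slAct_inv (A : Matrix.SpecialLinearGroup (Fin 2) (ZMod 3)) (p : ZMod 3 × ZMod 3) :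
    slAct A (slAct A⁻¹ p) = p := by
  rw [← slAct_mul, mul_inv_cancel, slAct_one]

theorem slAct_eq_zero_iff (A : Matrix.SpecialLinearGroup (Fin 2) (ZMod 3)) (p : ZMod 3 × ZMod 3) :
    slAct A p = 0 ↔ p = 0 := by
  refine ⟨fun h => ?_, fun h => by rw [h, slAct_zero]⟩
  rw [← slAct_inv_slAct A p, h, slAct_zero]

/-- The sign depends only on the determinant of the pair and on whether its sum vanishes. -/
theorem okuboSign_slAct (A : Matrix.SpecialLinearGroup (Fin 2) (ZMod 3)) (p q : ZMod 3 × ZMod 3) :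
    okuboSign (slAct A p) (slAct A q) = okuboSign p q := by
  have hdet := A.det_coe
  rw [Matrix.det_fin_two] at hdet
  have h : (slAct A p).1 * (slAct A q).2 - (slAct A p).2 * (slAct A q).1 =
      p.1 * q.2 - p.2 * q.1 := by
    simp only [slAct]
    linear_combination (p.1 * q.2 - p.2 * q.1) * hdet
  simp only [okuboSign, h, ← slAct_add, slAct_eq_zero_iff]

theorem slAct_one_zero (A : Matrix.SpecialLinearGroup (Fin 2) (ZMod 3)) :
    slAct A (1, 0) = (A 0 0, A 1 0) := by
  simp [slAct]

theorem slAct_zero_one (A : Matrix.SpecialLinearGroup (Fin 2) (ZMod 3)) :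
    slAct A (0, 1) = (A 0 1, A 1 1) := by
  simp [slAct]

/-- The action of `SL₂(ℤ/3)` on the indices of the basis. -/
def slIndex (A : Matrix.SpecialLinearGroup (Fin 2) (ZMod 3)) (a : OkuboIndex) : OkuboIndex :=
  ⟨slAct A a, fun h => a.2 ((slAct_eq_zero_iff A _).1 h)⟩

/-- The permutation of the basis vectors given by an element of `SL₂(ℤ/3)`. -/
def perm (α β : Fˣ) (A : Matrix.SpecialLinearGroup (Fin 2) (ZMod 3)) :
    Okubo α β ≃ₗ[F] Okubo α β where
  toFun x := fun a => x (slIndex A⁻¹ a)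
  invFun x := fun a => x (slIndex A a)
  map_add' x y := rfl
  map_smul' r x := rfl
  left_inv x := by
    funext a
    exact congrArg x (Subtype.ext (slAct_inv_slAct A a))
  right_inv x := by
    funext a
    exact congrArg x (Subtype.ext (slAct_slAct_inv A a))

theorem perm_apply (A : Matrix.SpecialLinearGroup (Fin 2) (ZMod 3)) (x : Okubo α β)
    (a : OkuboIndex) : perm α β A x a = x (slIndex A⁻¹ a) := rfl

theorem perm_z (A : Matrix.SpecialLinearGroup (Fin 2) (ZMod 3)) (a : ZMod 3 × ZMod 3) :
    perm α β A (z α β a) = z α β (slAct A a) := by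
  funext b
  rw [perm_apply, z_apply, z_apply]
  refine if_congr ⟨fun h => ?_, fun h => ?_⟩ rfl rfl
  · rw [← h]
    exact (slAct_slAct_inv A b).symm
  · change slAct A⁻¹ b = a
    rw [h, slAct_inv_slAct]

theorem isAlgIso_perm {A : Matrix.SpecialLinearGroup (Fin 2) (ZMod 3)}
    (hA : ∀ a b, coeff α β (slAct A a) (slAct A b) = coeff α β a b) : IsAlgIso (perm α β A) := by
  refine map_mul_of_z (perm α β A : Okubo α β →ₗ[F] Okubo α β) fun a b => ?_
  simp only [LinearEquiv.coe_coe]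
  rw [z_mul_z, map_smul, perm_z, perm_z, perm_z]
  refine Eq.trans ?_ (z_mul_z (slIndex A a) (slIndex A b)).symm
  simp only [slIndex, hA, slAct_add]

theorem map_perm (A : Matrix.SpecialLinearGroup (Fin 2) (ZMod 3))
    (g : Multiplicative (ZMod 3 × ZMod 3)) :
    ((grading α β).comp g).map (perm α β A : Okubo α β →ₗ[F] Okubo α β) =
      (grading α β).comp (.ofAdd (slAct A g.toAdd)) := by
  ext v
  rw [Submodule.mem_map]
  constructor
  · rintro ⟨u, hu, rfl⟩ a ha
    rw [LinearEquiv.coe_coe, perm_apply]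
    refine hu _ ?_
    rintro rfl
    refine ha (congrArg Multiplicative.ofAdd ?_)
    exact (slAct_slAct_inv A a).symm
  · intro hv
    refine ⟨(perm α β A).symm v, fun a ha => ?_, (perm α β A).apply_symm_apply v⟩
    refine hv (slIndex A a) fun h => ha ?_
    have h1 := congrArg (slAct A⁻¹) (Multiplicative.ofAdd.injective h)
    rw [slAct_inv_slAct] at h1
    rw [show (a : ZMod 3 × ZMod 3) = g.toAdd from (slAct_inv_slAct A a).symm.trans h1]
    rfl

/-- The permutation of the basis, as an automorphism of the graded algebra. -/
def permAut {A : Matrix.SpecialLinearGroup (Fin 2) (ZMod 3)}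
    (hA : ∀ a b, coeff α β (slAct A a) (slAct A b) = coeff α β a b) : (grading α β).autGroup :=
  ⟨perm α β A, isAlgIso_perm hA, fun g _ => ⟨_, map_perm A g⟩⟩

theorem coe_permAut {A : Matrix.SpecialLinearGroup (Fin 2) (ZMod 3)}
    (hA : ∀ a b, coeff α β (slAct A a) (slAct A b) = coeff α β a b) :
    (permAut hA : Okubo α β ≃ₗ[F] Okubo α β) = perm α β A := rfl

theorem perm_one : perm α β 1 = 1 :=
  linearEquiv_ext fun a => by rw [perm_z, slAct_one, LinearEquiv.coe_one, id]

theorem perm_mul (A B : Matrix.SpecialLinearGroup (Fin 2) (ZMod 3)) :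
    perm α β (A * B) = perm α β A * perm α β B :=
  linearEquiv_ext fun a => by rw [LinearEquiv.mul_apply, perm_z, perm_z, perm_z, slAct_mul]

section Weyl

variable {K : Type*} [Group K] (j : K →* Matrix.SpecialLinearGroup (Fin 2) (ZMod 3))
  (hj : ∀ k a b, coeff α β (slAct (j k) a) (slAct (j k) b) = coeff α β a b)

/-- The automorphisms permuting the basis, for a group acting through symmetries of the structure
constants. -/
def permHom : K →* (grading α β).autGroup where
  toFun k := permAut (hj k)
  map_one' := by
    refine Subtype.ext ?_
    rw [coe_permAut, map_one, perm_one, Subgroup.coe_one]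
  map_mul' k l := by
    refine Subtype.ext ?_
    rw [Subgroup.coe_mul, coe_permAut, coe_permAut, coe_permAut, map_mul, perm_mul]

theorem permHom_z (k : K) (a : ZMod 3 × ZMod 3) :
    (permHom j hj k : Okubo α β ≃ₗ[F] Okubo α β) (z α β a) = z α β (slAct (j k) a) :=
  perm_z _ a

theorem z_eq_smul_z {a b : OkuboIndex} {k : F} (h : z α β a = k • z α β b) : a = b := by
  by_contra hab
  have h1 := congrFun h a
  rw [smul_apply, z_apply, z_apply, if_pos rfl, if_neg (fun h => hab (Subtype.ext h)),
    mul_zero] at h1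
  exact one_ne_zero h1

theorem eq_one_of_permHom_mem (hinj : Function.Injective j) {k : K}
    (hk : permHom j hj k ∈ (grading α β).stabGroup) : k = 1 := by
  have key : ∀ a : OkuboIndex, slAct (j k) a = a := by
    intro a
    obtain ⟨r, hr⟩ := exists_eq_smul_of_mem_stabGroup hk a
    rw [permHom_z] at hr
    exact congrArg Subtype.val (z_eq_smul_z (a := slIndex (j k) a) hr)
  have h1 := key ⟨(1, 0), by decide⟩
  have h2 := key ⟨(0, 1), by decide⟩
  simp only [slAct_one_zero, slAct_zero_one, Prod.mk.injEq] at h1 h2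
  refine hinj ?_
  rw [map_one]
  ext p q
  fin_cases p <;> fin_cases q
  · exact h1.1
  · exact h2.1
  · exact h1.2
  · exact h2.2

/-- The generators go to multiples of two basis vectors whose indices form the columns of a matrix
of determinant one that preserves cube classes. Undoing this matrix leaves a map that is diagonal on
the generators. -/
theorem exists_permHom_inv_mul_mem
    (hsurj : ∀ A, cubeHom α β (.ofAdd (slAct A (1, 0))) = cubeHom α β (.ofAdd (1, 0)) →
      cubeHom α β (.ofAdd (slAct A (0, 1))) = cubeHom α β (.ofAdd (0, 1)) → ∃ k, j k = A)
    (ψ : (grading α β).autGroup) : ∃ k, (permHom j hj k)⁻¹ * ψ ∈ (grading α β).stabGroup := by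
  obtain ⟨c, r, hc, hc'⟩ := exists_map_z ψ.2 ⟨(1, 0), by decide⟩
  obtain ⟨d, s, hd, hd'⟩ := exists_map_z ψ.2 ⟨(0, 1), by decide⟩
  have hdet := det_eq_one ψ.2.1 hc hd
  let A : Matrix.SpecialLinearGroup (Fin 2) (ZMod 3) :=
    ⟨!![c.1.1, d.1.1; c.1.2, d.1.2], by
      rw [Matrix.det_fin_two_of, ← hdet]
      ring⟩
  have hA1 : slAct A (1, 0) = c := slAct_one_zero A
  have hA2 : slAct A (0, 1) = d := slAct_zero_one A
  obtain ⟨k, hk⟩ := hsurj A (by rw [hA1]; exact hc'.symm) (by rw [hA2]; exact hd'.symm)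
  refine ⟨k, mem_stabGroup (k := r) (l := s) ?_ ?_⟩
  · change (permHom j hj k : Okubo α β ≃ₗ[F] Okubo α β).symm
      ((ψ : Okubo α β ≃ₗ[F] Okubo α β) (z α β (1, 0))) = _
    rw [LinearEquiv.symm_apply_eq, map_smul, permHom_z, hk, hA1]
    exact hc
  · change (permHom j hj k : Okubo α β ≃ₗ[F] Okubo α β).symm
      ((ψ : Okubo α β ≃ₗ[F] Okubo α β) (z α β (0, 1))) = _
    rw [LinearEquiv.symm_apply_eq, map_smul, permHom_z, hk, hA2]
    exact hd

end Weyl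

end Okubo

/-! ### Counting in the cube classes and cubic roots of unity. -/

section CubeClasses

variable {F : Type*} [Field F]

theorem cubeClass_pow_three (α : Fˣ) : cubeClass α ^ 3 = 1 :=
  (QuotientGroup.eq_one_iff _).2 ⟨α, rfl⟩

theorem cubeClass_one : cubeClass (1 : Fˣ) = 1 := rfl

theorem cubeClass_surjective : Function.Surjective (cubeClass (F := F)) :=
  QuotientGroup.mk_surjective

theorem cubeHom_apply (α β : Fˣ) (c : ZMod 3 × ZMod 3) :
    cubeHom α β (.ofAdd c) = cubeClass α ^ c.1.val * cubeClass β ^ c.2.val := rfl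

theorem cubeHom_one_zero (α β : Fˣ) : cubeHom α β (.ofAdd (1, 0)) = cubeClass α :=
  zmodThreeHom_one_zero _ _ _ _

theorem cubeHom_zero_one (α β : Fˣ) : cubeHom α β (.ofAdd (0, 1)) = cubeClass β :=
  zmodThreeHom_zero_one _ _ _ _

theorem cubeHom_swap (α β : Fˣ) (c : ZMod 3 × ZMod 3) :
    cubeHom β α (.ofAdd c) = cubeHom α β (.ofAdd c.swap) := by
  rw [cubeHom_apply, cubeHom_apply]
  exact mul_comm (cubeClass β ^ _) _

theorem card_zmodThree_prod : Nat.card (Multiplicative (ZMod 3 × ZMod 3)) = 9 := by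
  rw [Nat.card_congr Multiplicative.toAdd, Nat.card_prod, Nat.card_zmod]

theorem injective_of_card_range {M : Type*} [Group M] {f : Multiplicative (ZMod 3 × ZMod 3) →* M}
    (h : Nat.card f.range = 9) : Function.Injective f := by
  have h1 := f.rangeRestrict_surjective.bijective_of_nat_card_le
    (by rw [h, card_zmodThree_prod])
  exact fun x y hxy => h1.1 (Subtype.ext hxy)

theorem pow_val_injective {M : Type*} [Group M] {x : M} (hx : x ^ 3 = 1) (hx1 : x ≠ 1)
    {i j : ZMod 3}
    (h : x ^ i.val = x ^ j.val) : i = j := by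
  have ho : orderOf x = 3 := by
    have : Fact (Nat.Prime 3) := ⟨Nat.prime_three⟩
    exact orderOf_eq_prime hx hx1
  refine ZMod.val_injective 3 (pow_injOn_Iio_orderOf ?_ ?_ h)
  · rw [ho]
    exact ZMod.val_lt i
  · rw [ho]
    exact ZMod.val_lt j

theorem card_zpowers_le_three {M : Type*} [Group M] {x : M} (hx : x ^ 3 = 1) :
    Nat.card (Subgroup.zpowers x) ≤ 3 := by
  rw [Nat.card_zpowers]
  exact Nat.le_of_dvd (by norm_num) (orderOf_dvd_of_pow_eq_one hx)

end CubeClasses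

section RootsOfUnity

variable {F : Type*} [Field F]

theorem subsingleton_rootsOfUnity_three
    (h : ringChar F = 3 ∨ (ringChar F ≠ 3 ∧ ¬ ∃ ω : F, IsPrimitiveRoot ω 3)) :
    Subsingleton (rootsOfUnity 3 F) := by
  have key : ∀ u : rootsOfUnity 3 F, u = 1 := by
    rintro ⟨u, hu⟩
    have hu3 : (u : F) ^ 3 = 1 := by
      have := (mem_rootsOfUnity _ _).1 hu
      rw [← Units.val_pow_eq_pow_val, this, Units.val_one]
    refine Subtype.ext (Units.ext ?_)
    change (u : F) = 1
    by_contra hu1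
    rcases h with h | ⟨-, h⟩
    · have h3 : (3 : F) = 0 := by
        have := ringChar.Nat.cast_ringChar (R := F)
        rw [h] at this
        exact_mod_cast this
      -- In characteristic three, `(u - 1)³ = u³ - 1`.
      have : ((u : F) - 1) ^ 3 = 0 := by
        linear_combination hu3 - ((u : F) ^ 2 - u) * h3
      exact hu1 (sub_eq_zero.1 (pow_eq_zero_iff (by norm_num) |>.1 this))
    · have : Fact (Nat.Prime 3) := ⟨Nat.prime_three⟩
      exact h ⟨u, orderOf_eq_prime hu3 hu1 ▸ IsPrimitiveRoot.orderOf (u : F)⟩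
  exact ⟨fun u v => (key u).trans (key v).symm⟩

theorem nonempty_rootsOfUnity_three (h : ∃ ω : F, IsPrimitiveRoot ω 3) :
    Nonempty (rootsOfUnity 3 F ≃* Multiplicative (ZMod 3)) := by
  obtain ⟨ω, hω⟩ := h
  have : Fact (Nat.Prime 3) := ⟨Nat.prime_three⟩
  refine ⟨mulEquivOfPrimeCardEq (p := 3) ?_ ?_⟩
  · exact hω.card_rootsOfUnity
  · rw [Nat.card_congr Multiplicative.toAdd, Nat.card_zmod]

end RootsOfUnity

/-! ### Symmetries of the structure constants. -/

namespace Okubo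

open Matrix

/-- The subgroup of `SL₂(ℤ/3)` of the shears along the first coordinate. -/
def shear : Multiplicative (ZMod 3) →* SpecialLinearGroup (Fin 2) (ZMod 3) where
  toFun k := ⟨!![1, k.toAdd; 0, 1], by simp⟩
  map_one' := by
    ext p q
    fin_cases p <;> fin_cases q <;> rfl
  map_mul' k l := by
    refine Subtype.ext ?_
    change _ = !![1, k.toAdd; 0, 1] * !![1, l.toAdd; 0, 1]
    rw [mul_fin_two]
    simp [add_comm]

theorem slAct_shear (k : Multiplicative (ZMod 3)) (p : ZMod 3 × ZMod 3) :
    slAct (shear k) p = (p.1 + k.toAdd * p.2, p.2) := by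
  have h00 : shear k 0 0 = 1 := rfl
  have h01 : shear k 0 1 = k.toAdd := rfl
  have h10 : shear k 1 0 = 0 := rfl
  have h11 : shear k 1 1 = 1 := rfl
  simp [slAct, h00, h01, h10, h11]

variable {F : Type*} [Field F]

theorem coeff_one_one_slAct (A : SpecialLinearGroup (Fin 2) (ZMod 3)) (a b : ZMod 3 × ZMod 3) :
    coeff (1 : Fˣ) 1 (slAct A a) (slAct A b) = coeff (1 : Fˣ) 1 a b := by
  simp [coeff, okuboSign_slAct]

/-- A shear alters only the first index, whose carries are weighted by the parameter `1`. -/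
theorem coeff_one_shear (β : Fˣ) (k : Multiplicative (ZMod 3)) (a b : ZMod 3 × ZMod 3) :
    coeff 1 β (slAct (shear k) a) (slAct (shear k) b) = coeff 1 β a b := by
  simp only [coeff, okuboSign_slAct]
  simp only [slAct_shear, Units.val_one, one_pow]

theorem shear_injective : Function.Injective shear := by
  intro k l h
  exact congrArg (fun A : SpecialLinearGroup (Fin 2) (ZMod 3) => A 0 1) h

theorem sl_ext {A B : SpecialLinearGroup (Fin 2) (ZMod 3)} (h₁ : slAct A (1, 0) = slAct B (1, 0))
    (h₂ : slAct A (0, 1) = slAct B (0, 1)) : A = B := by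
  simp only [slAct_one_zero, slAct_zero_one, Prod.mk.injEq] at h₁ h₂
  ext p q
  fin_cases p <;> fin_cases q
  · exact h₁.1
  · exact h₂.1
  · exact h₁.2
  · exact h₂.2

/-- Preserving powers of a nontrivial class fixes the second coordinate, so the bottom row of `A` is
`(0, 1)`; the determinant then makes the corner entry `1`. -/
theorem exists_shear_eq {β : Fˣ} (hβ : cubeClass β ≠ 1) (A : SpecialLinearGroup (Fin 2) (ZMod 3))
    (h₁ : cubeHom 1 β (.ofAdd (slAct A (1, 0))) = cubeHom 1 β (.ofAdd (1, 0)))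
    (h₂ : cubeHom 1 β (.ofAdd (slAct A (0, 1))) = cubeHom 1 β (.ofAdd (0, 1))) :
    ∃ k, shear k = A := by
  have key : ∀ c d : ZMod 3 × ZMod 3, cubeHom 1 β (.ofAdd c) = cubeHom 1 β (.ofAdd d) →
      c.2 = d.2 := by
    intro c d h
    rw [cubeHom_apply, cubeHom_apply, cubeClass_one, one_pow, one_pow, one_mul, one_mul] at h
    exact pow_val_injective (cubeClass_pow_three β) hβ h
  have h10 : A 1 0 = 0 := by
    have := key _ _ h₁
    rwa [slAct_one_zero] at this
  have h11 : A 1 1 = 1 := by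
    have := key _ _ h₂
    rwa [slAct_zero_one] at this
  have hdet := A.det_coe
  rw [det_fin_two, h10, h11, mul_one, mul_zero, sub_zero] at hdet
  refine ⟨.ofAdd (A 0 1), sl_ext ?_ ?_⟩
  · rw [slAct_shear, slAct_one_zero, h10, hdet]
    simp
  · rw [slAct_shear, slAct_zero_one, h11]
    simp

end Okubo

/-! ### Normal forms according to the image of `Φ`. -/

namespace OkuboCoords

open AlgGrading Okubo

variable {F O G : Type*} [Field F] [NonUnitalNonAssocRing O] [Module F O] [CommGroup G]
  {Γ : AlgGrading F O G} {α β : Fˣ}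

/-- The product determines the norm through `(x*y)*x = n(x) y` for a single `y ≠ 0`, so an algebra
isomorphism is automatically an isometry. -/
theorem isSplitOkubo {n : QuadraticForm F O} (hn : IsSymComp n)
    (C : OkuboCoords Γ (1 : Fˣ) 1) : IsSplitOkubo n := by
  refine ⟨C.toEquiv, C.isAlgIso, fun x => ?_⟩
  have h := congrArg C.toEquiv (hn.mul_mul_self x (C.toEquiv.symm (z 1 1 (1, 0))))
  rw [C.isAlgIso, C.isAlgIso, isSymComp_one_one.mul_mul_self, map_smul,
    LinearEquiv.apply_symm_apply] at h
  exact smul_left_injective F (z_ne_zero ⟨(1, 0), by decide⟩) h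

theorem weylGroup_split (C : OkuboCoords Γ (1 : Fˣ) 1) : Γ.WeylSequenceSplits ∧
    Nonempty (Γ.weylGroup ≃* Matrix.SpecialLinearGroup (Fin 2) (ZMod 3)) :=
  C.equivalent.weylGroup (permHom (MonoidHom.id _) coeff_one_one_slAct)
    (fun _ => eq_one_of_permHom_mem _ _ Function.injective_id)
    (exists_permHom_inv_mul_mem _ _ fun A _ _ => ⟨A, rfl⟩)

theorem weylGroup_cyclic (C : OkuboCoords Γ 1 β) (hβ : cubeClass β ≠ 1) :
    Γ.WeylSequenceSplits ∧ Nonempty (Γ.weylGroup ≃* Multiplicative (ZMod 3)) :=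
  C.equivalent.weylGroup (permHom shear (coeff_one_shear β))
    (fun _ => eq_one_of_permHom_mem _ _ shear_injective)
    (exists_permHom_inv_mul_mem _ _ (exists_shear_eq hβ))

theorem weylGroup_trivial (C : OkuboCoords Γ α β) (hinj : Function.Injective (cubeHom α β)) :
    Γ.WeylSequenceSplits ∧ Nonempty (Γ.weylGroup ≃* Unit) := by
  refine C.equivalent.weylGroup (permHom (1 : Unit →* _) fun _ a b => ?_)
    (fun _ _ => rfl) (exists_permHom_inv_mul_mem _ _ fun A h₁ h₂ => ⟨1, ?_⟩)
  · rw [MonoidHom.one_apply, slAct_one, slAct_one]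
  · rw [map_one]
    refine sl_ext ?_ ?_
    · rw [slAct_one]
      exact (Multiplicative.ofAdd.injective (hinj h₁)).symm
    · rw [slAct_one]
      exact (Multiplicative.ofAdd.injective (hinj h₂)).symm

/-- The range of `Φ_Γ`, in coordinates. -/
theorem range_phi (C : OkuboCoords Γ α β) : C.phi.range = (cubeHom α β).range := by
  refine le_antisymm ?_ ?_
  · rintro _ ⟨h, rfl⟩
    exact ⟨C.degEquiv.symm h, rfl⟩
  · rintro _ ⟨c, rfl⟩
    exact ⟨C.degEquiv c, congrArg (cubeHom α β) (C.degEquiv.symm_apply_apply c)⟩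

variable [IsScalarTower F O O] [SMulCommClass F O O] {n : QuadraticForm F O}

theorem nonempty_one_one (hn : IsSymComp n) (hdim : Module.finrank F O = 8) (hΓ : Γ.IsSpecial)
    (C : OkuboCoords Γ α β) (h : (cubeHom α β).range = ⊥) :
    Nonempty (OkuboCoords Γ (1 : Fˣ) 1) := by
  have h1 : ∀ a : ZMod 3 × ZMod 3, cubeHom α β (.ofAdd a) = cubeClass 1 := by
    intro a
    have : cubeHom α β (.ofAdd a) ∈ (cubeHom α β).range := ⟨_, rfl⟩
    rw [h] at this
    exact Subgroup.mem_bot.1 this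
  exact C.nonempty_of_cubeHom hn hΓ hdim (a := ⟨(1, 0), by decide⟩) (b := ⟨(0, 1), by decide⟩)
    (by decide) (h1 _) (h1 _)

/-- Counting gives a nonzero `m` in the kernel, and a preimage `k` of the class of `γ` lies off its
line. After replacing `m` by `2m` if necessary, `(m, k)` has determinant one, and its classes are
`1` and `γ`. -/
theorem nonempty_one_of_card (hn : IsSymComp n) (hdim : Module.finrank F O = 8)
    (hΓ : Γ.IsSpecial) (C : OkuboCoords Γ α β) (hcard : Nat.card (cubeHom α β).range = 3) {γ : Fˣ}
    (hγ : Subgroup.zpowers (cubeClass γ) = (cubeHom α β).range) :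
    cubeClass γ ≠ 1 ∧ Nonempty (OkuboCoords Γ 1 γ) := by
  have hγ1 : cubeClass γ ≠ 1 := by
    intro h
    rw [← hγ, h, Subgroup.zpowers_one_eq_bot, Subgroup.card_bot] at hcard
    omega
  refine ⟨hγ1, ?_⟩
  obtain ⟨k, hk⟩ : ∃ k : ZMod 3 × ZMod 3, cubeHom α β (.ofAdd k) = cubeClass γ := by
    have : cubeClass γ ∈ (cubeHom α β).range := hγ ▸ Subgroup.mem_zpowers _
    exact this
  obtain ⟨m, hm0, hm⟩ : ∃ m : ZMod 3 × ZMod 3, m ≠ 0 ∧ cubeHom α β (.ofAdd m) = 1 := by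
    by_contra! h
    have hinj : Function.Injective (cubeHom α β) := by
      refine (injective_iff_map_eq_one _).2 fun c hc => ?_
      by_contra hc1
      exact h c.toAdd hc1 hc
    rw [Nat.card_congr (MonoidHom.ofInjective hinj).symm.toEquiv, card_zmodThree_prod] at hcard
    omega
  have hk0 : k ≠ 0 := by
    rintro rfl
    rw [ofAdd_zero, map_one] at hk
    exact hγ1 hk.symm
  have hdet : ∀ m k : ZMod 3 × ZMod 3, m ≠ 0 → m.1 * k.2 - m.2 * k.1 = 1 ∨
      (m + m).1 * k.2 - (m + m).2 * k.1 = 1 ∧ m + m ≠ 0 ∨ k = 0 ∨ k = m ∨ k = m + m := by decide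
  have hmm : cubeHom α β (.ofAdd (m + m)) = 1 := by
    rw [ofAdd_add, map_mul, hm]
    exact one_mul (1 : CubeClasses F)
  rcases hdet m k hm0 with h | ⟨h, h0⟩ | rfl | rfl | rfl
  · exact C.nonempty_of_cubeHom hn hΓ hdim (a := ⟨m, hm0⟩) (b := ⟨k, hk0⟩) h hm hk
  · exact C.nonempty_of_cubeHom hn hΓ hdim (a := ⟨_, h0⟩) (b := ⟨k, hk0⟩) h hmm hk
  · exact absurd rfl hk0
  · exact absurd (hk.symm.trans hm) hγ1
  · exact absurd (hk.symm.trans hmm) hγ1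

/-- Preimages of the two classes have determinant `1` in one of the two orders. Otherwise both would
lie on one line, and the image would have at most three elements. -/
theorem nonempty_or_of_card (hn : IsSymComp n) (hdim : Module.finrank F O = 8)
    (hΓ : Γ.IsSpecial) (C : OkuboCoords Γ α β) (hcard : Nat.card (cubeHom α β).range = 9) {γ δ : Fˣ}
    (hγδ : Subgroup.closure {cubeClass γ, cubeClass δ} = (cubeHom α β).range) :
    Nonempty (OkuboCoords Γ γ δ) ∨ Nonempty (OkuboCoords Γ δ γ) := by
  have hex : ∀ {x : CubeClasses F}, x ∈ ({cubeClass γ, cubeClass δ} : Set (CubeClasses F)) →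
      ∃ k : ZMod 3 × ZMod 3, cubeHom α β (.ofAdd k) = x := by
    intro x hx
    have : x ∈ (cubeHom α β).range := hγδ ▸ Subgroup.subset_closure hx
    exact this
  obtain ⟨h, hh⟩ := hex (Set.mem_insert _ _)
  obtain ⟨k, hk⟩ := hex (Set.mem_insert_of_mem _ (Set.mem_singleton _))
  have hdet : ∀ h k : ZMod 3 × ZMod 3, (h.1 * k.2 - h.2 * k.1 = 1 ∧ h ≠ 0 ∧ k ≠ 0) ∨
      (k.1 * h.2 - k.2 * h.1 = 1 ∧ h ≠ 0 ∧ k ≠ 0) ∨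
      ∃ m : ZMod 3 × ZMod 3, (h = 0 ∨ h = m ∨ h = m + m) ∧ (k = 0 ∨ k = m ∨ k = m + m) := by
    decide
  rcases hdet h k with ⟨h1, hh0, hk0⟩ | ⟨h1, hh0, hk0⟩ | ⟨m, hm, hm'⟩
  · exact Or.inl (C.nonempty_of_cubeHom hn hΓ hdim (a := ⟨h, hh0⟩) (b := ⟨k, hk0⟩) h1 hh hk)
  · exact Or.inr (C.nonempty_of_cubeHom hn hΓ hdim (a := ⟨k, hk0⟩) (b := ⟨h, hh0⟩) h1 hk hh)
  · exfalso
    have hmem : ∀ l : ZMod 3 × ZMod 3, (l = 0 ∨ l = m ∨ l = m + m) →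
        cubeHom α β (.ofAdd l) ∈ Subgroup.zpowers (cubeHom α β (.ofAdd m)) := by
      rintro l (rfl | rfl | rfl)
      · rw [ofAdd_zero, map_one]
        exact one_mem _
      · exact Subgroup.mem_zpowers _
      · rw [ofAdd_add, map_mul]
        exact mul_mem (Subgroup.mem_zpowers _) (Subgroup.mem_zpowers _)
    have hle : (cubeHom α β).range ≤ Subgroup.zpowers (cubeHom α β (.ofAdd m)) := by
      rw [← hγδ, Subgroup.closure_le]
      rintro x (rfl | rfl)
      · rw [← hh]
        exact hmem h hm
      · rw [← hk]
        exact hmem k hm'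
    have hcube := cubeClass_pow_three (α ^ m.1.val * β ^ m.2.val)
    rw [← cubeHom_ofAdd] at hcube
    have hfin : Finite (Subgroup.zpowers (cubeHom α β (.ofAdd m))) :=
      finite_zpowers.2 (isOfFinOrder_iff_pow_eq_one.2 ⟨3, by norm_num, hcube⟩)
    have h1 := Subgroup.card_le_of_le hle
    have h2 := card_zpowers_le_three hcube
    omega

end OkuboCoords

namespace Okubo

open AlgGrading

variable {F : Type*} [Field F] {α β : Fˣ}

/-- Injectivity on cube classes would force the equivalence to exchange the two degrees, a map of
determinant `-1`. -/
theorem not_equivalent_swap (hinj : Function.Injective (cubeHom α β)) :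
    ¬ (grading α β).Equivalent (grading β α) := by
  rintro ⟨φ, hφ⟩
  obtain ⟨c, k, hc, hc'⟩ := exists_map_z hφ ⟨(1, 0), by decide⟩
  obtain ⟨d, l, hd, hd'⟩ := exists_map_z hφ ⟨(0, 1), by decide⟩
  have hdet := det_eq_one hφ.1 hc hd
  replace hc' := hc'.trans (cubeHom_swap α β c)
  replace hd' := hd'.trans (cubeHom_swap α β d)
  have h1 : (c : ZMod 3 × ZMod 3) = (0, 1) :=
    Prod.swap_injective (Multiplicative.ofAdd.injective (hinj hc')).symm
  have h2 : (d : ZMod 3 × ZMod 3) = (1, 0) :=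
    Prod.swap_injective (Multiplicative.ofAdd.injective (hinj hd')).symm
  rw [h1, h2] at hdet
  exact absurd hdet (by decide)

/-- The image contains a group of order 9 and the source has 9 elements. -/
theorem cubeHom_injective_of_closure {H : Subgroup (CubeClasses F)} (hH : Nat.card H = 9)
    (h : Subgroup.closure {cubeClass α, cubeClass β} = H) : Function.Injective (cubeHom α β) := by
  have hle : H ≤ (cubeHom α β).range := by
    rw [← h, Subgroup.closure_le]
    rintro x (rfl | rfl)
    · exact ⟨_, cubeHom_one_zero α β⟩
    · exact ⟨_, cubeHom_zero_one α β⟩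
  have hfin : Finite (cubeHom α β).range :=
    Finite.of_surjective _ (cubeHom α β).rangeRestrict_surjective
  have h1 := Subgroup.card_le_of_le hle
  have h2 := Nat.le_of_dvd (by rw [card_zmodThree_prod]; norm_num)
    (Subgroup.card_range_dvd (cubeHom α β))
  rw [card_zmodThree_prod] at h2
  exact injective_of_card_range (by omega)

end Okubo

/-! ### Assembling the cases. -/

theorem mainTheorem1 {F O G : Type*} [Field F] [NonUnitalNonAssocRing O] [Module F O]
    [IsScalarTower F O O] [SMulCommClass F O O] [CommGroup G]
    (n : QuadraticForm F O) (hO : IsOkubo n)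
    (Γ : AlgGrading F O G) (hΓ : Γ.IsSpecial) :
    -- the sequence `1 → Stab(Γ) → Aut(Γ) → W(Γ) → 1` splits
    Γ.WeylSequenceSplits ∧
    -- `Stab(Γ) = μ₃(F)²`
    Nonempty (Γ.stabGroup ≃* rootsOfUnity 3 F × rootsOfUnity 3 F) ∧
    (ringChar F = 3 ∨ (ringChar F ≠ 3 ∧ ¬ ∃ ω : F, IsPrimitiveRoot ω 3) →
      Subsingleton Γ.stabGroup) ∧
    (ringChar F ≠ 3 ∧ (∃ ω : F, IsPrimitiveRoot ω 3) →
      Nonempty (Γ.stabGroup ≃* Multiplicative (ZMod 3 × ZMod 3))) ∧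
    -- the map `Φ_Γ` and the three possibilities for its image
    ∃ Φ : Γ.suppSubgroup →* CubeClasses F, IsPhi n Γ Φ ∧
      (Φ.range = ⊥ ∨ (IsCyclic Φ.range ∧ Nat.card Φ.range = 3) ∨
        Nonempty (Φ.range ≃* Multiplicative (ZMod 3 × ZMod 3))) ∧
      (Φ.range = ⊥ →
        IsSplitOkubo n ∧
        Γ.Equivalent (Okubo.grading (1 : Fˣ) 1) ∧
        Nonempty (Γ.weylGroup ≃* Matrix.SpecialLinearGroup (Fin 2) (ZMod 3))) ∧
      (IsCyclic Φ.range ∧ Nat.card Φ.range = 3 →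
        (∀ α : Fˣ, Subgroup.zpowers (cubeClass α) = Φ.range →
          Γ.Equivalent (Okubo.grading 1 α)) ∧
        IsCyclic Γ.weylGroup ∧ Nat.card Γ.weylGroup = 3) ∧
      (Nonempty (Φ.range ≃* Multiplicative (ZMod 3 × ZMod 3)) →
        Subsingleton Γ.weylGroup ∧
        ∀ α β : Fˣ, Subgroup.closure {cubeClass α, cubeClass β} = Φ.range →
          (Γ.Equivalent (Okubo.grading α β) ∨ Γ.Equivalent (Okubo.grading β α)) ∧
            ¬ (Γ.Equivalent (Okubo.grading α β) ∧ Γ.Equivalent (Okubo.grading β α))) := by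
  have hn := hO.isSymComp
  have hdim := hO.finrank_eq
  obtain ⟨α₀, β₀, ⟨C⟩⟩ := hΓ.exists_okuboCoords hn hdim
  obtain ⟨e⟩ := C.equivalent.nonempty_stabGroup
  obtain ⟨e'⟩ := Okubo.nonempty_stabGroup α₀ β₀
  have hcyclic : Nat.card (cubeHom α₀ β₀).range = 3 →
      Γ.WeylSequenceSplits ∧ Nonempty (Γ.weylGroup ≃* Multiplicative (ZMod 3)) := by
    intro h
    have : Fact (Nat.Prime 3) := ⟨Nat.prime_three⟩
    have := isCyclic_of_prime_card h
    obtain ⟨x, hx⟩ := Subgroup.isCyclic_iff_exists_zpowers_eq_top _ |>.1 this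
    obtain ⟨γ, rfl⟩ := cubeClass_surjective x
    obtain ⟨h1, ⟨C'⟩⟩ := C.nonempty_one_of_card hn hdim hΓ h hx
    exact C'.weylGroup_cyclic h1
  have hfull : Nat.card (cubeHom α₀ β₀).range = 9 →
      Γ.WeylSequenceSplits ∧ Nonempty (Γ.weylGroup ≃* Unit) := fun h =>
    C.weylGroup_trivial (injective_of_card_range h)
  have hcases : (cubeHom α₀ β₀).range = ⊥ ∨ Nat.card (cubeHom α₀ β₀).range = 3 ∨
      Nat.card (cubeHom α₀ β₀).range = 9 := by
    -- The order of the image divides 9, hence the trichotomy, which also drives the proof of the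
    -- splitting.
    have h := Subgroup.card_range_dvd (cubeHom α₀ β₀)
    rw [card_zmodThree_prod, show 9 = 3 ^ 2 by norm_num, Nat.dvd_prime_pow Nat.prime_three] at h
    obtain ⟨k, hk, hk'⟩ := h
    interval_cases k
    · exact Or.inl (Subgroup.card_eq_one.1 hk')
    · exact Or.inr (Or.inl hk')
    · exact Or.inr (Or.inr hk')
  refine ⟨?_, ⟨e.trans e'⟩, fun h => ?_, fun h => ?_,
    C.phi, C.isPhi hn hΓ, ?_⟩
  · rcases hcases with h | h | h
    · obtain ⟨C'⟩ := C.nonempty_one_one hn hdim hΓ h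
      exact C'.weylGroup_split.1
    · exact (hcyclic h).1
    · exact (hfull h).1
  · have := subsingleton_rootsOfUnity_three h
    exact (e.trans e').toEquiv.subsingleton
  · obtain ⟨r⟩ := nonempty_rootsOfUnity_three h.2
    exact ⟨(e.trans e').trans ((r.prodCongr r).trans
      (MulEquiv.prodMultiplicative (G := ZMod 3) (H := ZMod 3)).symm)⟩
  rw [C.range_phi]
  refine ⟨?_, fun h => ?_, fun h => ⟨fun α hα => ?_, ?_⟩, fun h => ?_⟩
  · refine hcases.imp_right (Or.imp (fun h => ⟨?_, h⟩) fun h => ?_)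
    · have : Fact (Nat.Prime 3) := ⟨Nat.prime_three⟩
      exact isCyclic_of_prime_card h
    · exact ⟨(MonoidHom.ofInjective (injective_of_card_range h)).symm⟩
  · obtain ⟨C'⟩ := C.nonempty_one_one hn hdim hΓ h
    exact ⟨C'.isSplitOkubo hn, C'.equivalent, C'.weylGroup_split.2⟩
  · obtain ⟨-, ⟨C'⟩⟩ := C.nonempty_one_of_card hn hdim hΓ h.2 hα
    exact C'.equivalent
  · obtain ⟨w⟩ := (hcyclic h.2).2
    refine ⟨isCyclic_of_surjective w.symm w.symm.surjective, ?_⟩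
    rw [Nat.card_congr w.toEquiv, Nat.card_congr Multiplicative.toAdd, Nat.card_zmod]
  · obtain ⟨r⟩ := h
    have hcard : Nat.card (cubeHom α₀ β₀).range = 9 := by
      rw [Nat.card_congr r.toEquiv, card_zmodThree_prod]
    obtain ⟨w⟩ := (hfull hcard).2
    refine ⟨w.toEquiv.subsingleton, fun α β hαβ => ⟨?_, fun hboth => ?_⟩⟩
    · refine (C.nonempty_or_of_card hn hdim hΓ hcard hαβ).imp ?_ ?_
      · rintro ⟨C'⟩
        exact C'.equivalent
      · rintro ⟨C'⟩
        exact C'.equivalent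
    -- Composing the two equivalences through `Γ` would identify `Γ_{α,β}` with `Γ_{β,α}`.
    · exact Okubo.not_equivalent_swap (Okubo.cubeHom_injective_of_closure hcard hαβ)
        (hboth.1.symm.trans hboth.2)
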